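/- Let $\mathcal C$ be the cube category: its objects $I,J,\dots$ are finite sets of names taken from a fixed countable set, and a map $J\to I$ is a function from $I$ to the free De Morgan algebra $\mathsf{dM}(J)$ on $J$. A cubical set is a presheaf on $\mathcal C$. Let $\mathbb I$ be the interval, $\mathbb I(I)=\mathsf{dM}(I)$, and let $\mathbb F$ be the cubical set of cofibrant propositions, where $\mathbb F(I)$ is the face lattice on $I$: the bounded distributive lattice generated by $(i=0),(i=1)$ for $i\in I$, with $(i=0)\wedge(i=1)=0_{\mathbb F}$. A type over a cubical set $\Gamma$ (a dependent presheaf) is a presheaf $A$ of sets, in a fixed universe, on the category of elements of $\Gamma$; a map of types over $\Gamma$ is a natural transformation; for $\sigma:\Delta\to\Gamma$, $A\sigma$ denotes the restriction of $A$ along $\sigma$, and substitution acts in the same way on all structure over $\Gamma$. A homogeneous composition structure $h_A$ on a type $A$ over $\Gamma$ gives, for all $I$, $\rho\in\Gamma(I)$, $\varphi\in\mathbb F(I)$, every family $u_{f,r}\in A(J,\rho f)$ indexed by $f:J\to I$ with $\varphi f=1$ and $r\in\mathbb I(J)$ such that $u_{f,r}g=u_{fg,rg}$ for $g:K\to J$,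 and every $u_0\in A(I,\rho)$ with $u_{f,0}=u_0f$ for all such $f$, an element $h_A\,\varphi\,u\,u_0\in A(I,\rho)$ with $(h_A\,\varphi\,u\,u_0)f=u_{f,1}$ whenever $\varphi f=1$; and it is natural: for every $f:J\to I$, $(h_A\,\varphi\,u\,u_0)f=h_A\,(\varphi f)\,(uf^+)\,(u_0f)$, where $(uf^+)_{g,r}=u_{fg,r}$. For a type $X$ over $\Gamma$, a $\Sigma X$-algebra over $\Gamma$ is a type $A$ over $\Gamma$ with a homogeneous composition structure $h_A$, two (natural) elements $n_A,s_A$ of $A$ over $\Gamma$, and a natural operation $l_A:X\times\mathbb I\to A$ over $\Gamma$ with $l_A\,x\,0=n_A$ and $l_A\,x\,1=s_A$. For a span $D=(C,A,B,u:C\to A,v:C\to B)$ of types over $\Gamma$, a $D$-algebra over $\Gamma$ is a type $Y$ over $\Gamma$ with a homogeneous composition structure $h_Y$, maps $i_Y:A\to Y$ and $j_Y:B\to Y$ over $\Gamma$, and a natural operation $p_Y:C\times\mathbb I\to Y$ over $\Gamma$ with $p_Y\,z\,0=i_Y(u\,z)$ and $p_Y\,z\,1=j_Y(v\,z)$. Maps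 of algebras are maps of types over $\Gamma$ that commute with all this structure, including the composition operations. Proposition. (1) For every cubical set $\Gamma$ and every type $X$ over $\Gamma$ there is an initial $\Sigma X$-algebra $(\Sigma X,\mathsf{hcomp},\mathsf N,\mathsf S,\mathsf{merid})$ over $\Gamma$, whose underlying type lies in the same universe as $X$. These algebras can be chosen for all $\Gamma$ and $X$ at once so that they are strictly stable under substitution: for every $\sigma:\Delta\to\Gamma$ one has $(\Sigma X)\sigma=\Sigma(X\sigma)$ as $\Sigma(X\sigma)$-algebras over $\Delta$. (The case of the unit context $\Gamma=1$ is that of a single cubical set $X$, and the case of representable $\Delta$ says that $\Sigma X$ is formed pointwise.) (2) For every cubical set $\Gamma$ and every span $D=(C,A,B,u,v)$ of types over $\Gamma$ there is an initial $D$-algebra $(A\sqcup_C B,\mathsf{hcomp},\mathsf{inl},\mathsf{inr},\mathsf{push})$ over $\Gamma$, whose underlying type lies in the same universe as $A$, $B$, $C$. These algebras can be chosen for all $\Gamma$ and $D$ at once so that, writing $\mathsf{po}(D)$ for the chosen one, $\mathsf{po}(D)\sigma=\mathsf{po}(D\sigma)$ as $D\sigma$-algebras over $\Delta$ for every $\sigma:\Delta\to\Gamma$.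 -/

import Mathlib

open CategoryTheory Opposite

universe w v

namespace CubicalSets

/-! ## Free De Morgan algebras -/

/-- De Morgan algebras: bounded distributive lattices with a De Morgan involution. -/
class DeMorganAlgebra (α : Type*) extends DistribLattice α, BoundedOrder α where
  /-- the De Morgan involution, written `1 - r` -/
  neg : α → α
  neg_neg : ∀ a, neg (neg a) = a
  neg_inf : ∀ a b, neg (a ⊓ b) = neg a ⊔ neg b

namespace DeMorganAlgebra

variable {α : Type*} [DeMorganAlgebra α]

theorem neg_sup (a b : α) : neg (a ⊔ b) = neg a ⊓ neg b := by
  rw [← neg_neg (neg a ⊓ neg b), neg_inf, neg_neg, neg_neg]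

theorem neg_top : neg (⊤ : α) = ⊥ := by
  have h : neg (⊤ ⊓ neg (⊥ : α)) = neg ⊤ ⊔ ⊥ := by rw [neg_inf, neg_neg]
  rw [top_inf_eq, neg_neg, sup_bot_eq] at h
  exact h.symm

theorem neg_bot : neg (⊥ : α) = ⊤ := by
  rw [← neg_top, neg_neg]

end DeMorganAlgebra

/-- Formal De Morgan expressions in the symbols `V`. -/
inductive DMTerm (V : Type) : Type
  | var : V → DMTerm V
  | zero : DMTerm V
  | one : DMTerm V
  | neg : DMTerm V → DMTerm V
  | meet : DMTerm V → DMTerm V → DMTerm V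
  | join : DMTerm V → DMTerm V → DMTerm V

/-- Equality of expressions that is derivable from the axioms of De Morgan algebras. -/
inductive DMTerm.Eqv {V : Type} : DMTerm V → DMTerm V → Prop
  | refl (a) : Eqv a a
  | symm {a b} : Eqv a b → Eqv b a
  | trans {a b c} : Eqv a b → Eqv b c → Eqv a c
  | neg_congr {a a'} : Eqv a a' → Eqv (neg a) (neg a')
  | meet_congr {a a' b b'} : Eqv a a' → Eqv b b' → Eqv (meet a b) (meet a' b')
  | join_congr {a a' b b'} : Eqv a a' → Eqv b b' → Eqv (join a b) (join a' b')
  | meet_comm (a b) : Eqv (meet a b) (meet b a)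
  | join_comm (a b) : Eqv (join a b) (join b a)
  | meet_assoc (a b c) : Eqv (meet (meet a b) c) (meet a (meet b c))
  | join_assoc (a b c) : Eqv (join (join a b) c) (join a (join b c))
  | meet_join (a b) : Eqv (meet a (join a b)) a
  | join_meet (a b) : Eqv (join a (meet a b)) a
  | distrib (a b c) : Eqv (meet a (join b c)) (join (meet a b) (meet a c))
  | zero_join (a) : Eqv (join zero a) a
  | one_meet (a) : Eqv (meet one a) a
  | neg_neg (a) : Eqv (neg (neg a)) a
  | neg_meet (a b) : Eqv (neg (meet a b)) (join (neg a) (neg b))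

/-- Derivable equality as a setoid. -/
def DMTerm.setoid (V : Type) : Setoid (DMTerm V) :=
  ⟨DMTerm.Eqv, DMTerm.Eqv.refl, DMTerm.Eqv.symm, DMTerm.Eqv.trans⟩

/-- The free De Morgan algebra `dM(V)` on the symbols `V`. -/
def FreeDM (V : Type) : Type := Quotient (DMTerm.setoid V)

namespace FreeDM

variable {V W U : Type}

/-- The class of an expression. -/
def mk (t : DMTerm V) : FreeDM V := Quotient.mk (DMTerm.setoid V) t

/-- The generators. -/
def var (i : V) : FreeDM V := mk (DMTerm.var i)

theorem mk_eq {a b : DMTerm V} (h : DMTerm.Eqv a b) : mk a = mk b := Quotient.sound h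

/-- Meets and joins on classes of expressions. -/
abbrev lattice : Lattice (FreeDM V) :=
  letI : Max (FreeDM V) :=
    ⟨Quotient.map₂ DMTerm.join fun _ _ h _ _ h' => DMTerm.Eqv.join_congr h h'⟩
  letI : Min (FreeDM V) :=
    ⟨Quotient.map₂ DMTerm.meet fun _ _ h _ _ h' => DMTerm.Eqv.meet_congr h h'⟩
  Lattice.mk'
    (by rintro ⟨a⟩ ⟨b⟩; exact mk_eq (.join_comm a b))
    (by rintro ⟨a⟩ ⟨b⟩ ⟨c⟩; exact mk_eq (.join_assoc a b c))
    (by rintro ⟨a⟩ ⟨b⟩; exact mk_eq (.meet_comm a b))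
    (by rintro ⟨a⟩ ⟨b⟩ ⟨c⟩; exact mk_eq (.meet_assoc a b c))
    (by rintro ⟨a⟩ ⟨b⟩; exact mk_eq (.join_meet a b))
    (by rintro ⟨a⟩ ⟨b⟩; exact mk_eq (.meet_join a b))

instance deMorganAlgebra : DeMorganAlgebra (FreeDM V) :=
  letI := lattice (V := V)
  { DistribLattice.ofInfSupLe (α := FreeDM V)
      (by rintro ⟨a⟩ ⟨b⟩ ⟨c⟩; exact le_of_eq (mk_eq (.distrib a b c))) with
    top := mk DMTerm.one
    bot := mk DMTerm.zero
    le_top := by rintro ⟨a⟩; exact inf_eq_right.1 (mk_eq (.one_meet a))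
    bot_le := by rintro ⟨a⟩; exact sup_eq_right.1 (mk_eq (.zero_join a))
    neg := Quotient.map DMTerm.neg fun _ _ h => DMTerm.Eqv.neg_congr h
    neg_neg := by rintro ⟨a⟩; exact mk_eq (.neg_neg a)
    neg_inf := by rintro ⟨a⟩ ⟨b⟩; exact mk_eq (.neg_meet a b) }

/-- Evaluation of expressions. -/
def eval {α : Type*} [DeMorganAlgebra α] (f : V → α) : DMTerm V → α
  | .var i => f i
  | .zero => ⊥
  | .one => ⊤
  | .neg a => DeMorganAlgebra.neg (eval f a)
  | .meet a b => eval f a ⊓ eval f b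
  | .join a b => eval f a ⊔ eval f b

theorem eval_eqv {α : Type*} [DeMorganAlgebra α] (f : V → α) {a b : DMTerm V}
    (h : DMTerm.Eqv a b) : eval f a = eval f b := by
  induction h with
  | refl => rfl
  | symm _ ih => exact ih.symm
  | trans _ _ ih ih' => exact ih.trans ih'
  | neg_congr _ ih => simp only [eval, ih]
  | meet_congr _ _ ih ih' => simp only [eval, ih, ih']
  | join_congr _ _ ih ih' => simp only [eval, ih, ih']
  | meet_comm => exact inf_comm _ _
  | join_comm => exact sup_comm _ _
  | meet_assoc => exact inf_assoc _ _ _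
  | join_assoc => exact sup_assoc _ _ _
  | meet_join => exact inf_sup_self
  | join_meet => exact sup_inf_self
  | distrib => exact inf_sup_left _ _ _
  | zero_join => exact bot_sup_eq _
  | one_meet => exact top_inf_eq _
  | neg_neg => exact DeMorganAlgebra.neg_neg _
  | neg_meet => exact DeMorganAlgebra.neg_inf _ _

/-- The homomorphism `dM(V) → α` induced by a map on generators. -/
def lift {α : Type*} [DeMorganAlgebra α] (f : V → α) : FreeDM V → α :=
  Quotient.lift (eval f) fun _ _ h => eval_eqv f h

/-- Substitution `dM(V) → dM(W)` along `V → dM(W)`. -/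
def subst (f : V → FreeDM W) : FreeDM V → FreeDM W := lift f

theorem subst_var (r : FreeDM V) : subst var r = r := by
  obtain ⟨t⟩ := r
  change eval var t = mk t
  induction t with
  | var i => rfl
  | zero => rfl
  | one => rfl
  | neg a ih => simp only [eval, ih]; rfl
  | meet a b ih ih' => simp only [eval, ih, ih']; rfl
  | join a b ih ih' => simp only [eval, ih, ih']; rfl

theorem lift_subst {α : Type*} [DeMorganAlgebra α] (f : V → FreeDM W) (g : W → α)
    (r : FreeDM V) : lift g (subst f r) = lift (fun i => lift g (f i)) r := by
  have hn : ∀ x, lift g (DeMorganAlgebra.neg x) = DeMorganAlgebra.neg (lift g x) := by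
    rintro ⟨x⟩; rfl
  have hm : ∀ x y, lift g (x ⊓ y) = lift g x ⊓ lift g y := by rintro ⟨x⟩ ⟨y⟩; rfl
  have hj : ∀ x y, lift g (x ⊔ y) = lift g x ⊔ lift g y := by rintro ⟨x⟩ ⟨y⟩; rfl
  obtain ⟨t⟩ := r
  change lift g (eval f t) = eval (fun i => lift g (f i)) t
  induction t with
  | var i => rfl
  | zero => rfl
  | one => rfl
  | neg a ih => simp only [eval, hn, ih]
  | meet a b ih ih' => simp only [eval, hm, ih, ih']
  | join a b ih ih' => simp only [eval, hj, ih, ih']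

end FreeDM

/-! ## The face lattice -/

/-- Formal face expressions; `eq0 i` and `eq1 i` stand for `(i = 0)` and `(i = 1)`. -/
inductive FaceTerm (V : Type) : Type
  | eq0 : V → FaceTerm V
  | eq1 : V → FaceTerm V
  | zero : FaceTerm V
  | one : FaceTerm V
  | meet : FaceTerm V → FaceTerm V → FaceTerm V
  | join : FaceTerm V → FaceTerm V → FaceTerm V

/-- Equality of face expressions derivable from the axioms of bounded distributive lattices
and `(i = 0) ∧ (i = 1) = 0`. -/
inductive FaceTerm.Eqv {V : Type} : FaceTerm V → FaceTerm V → Prop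
  | refl (a) : Eqv a a
  | symm {a b} : Eqv a b → Eqv b a
  | trans {a b c} : Eqv a b → Eqv b c → Eqv a c
  | meet_congr {a a' b b'} : Eqv a a' → Eqv b b' → Eqv (meet a b) (meet a' b')
  | join_congr {a a' b b'} : Eqv a a' → Eqv b b' → Eqv (join a b) (join a' b')
  | meet_comm (a b) : Eqv (meet a b) (meet b a)
  | join_comm (a b) : Eqv (join a b) (join b a)
  | meet_assoc (a b c) : Eqv (meet (meet a b) c) (meet a (meet b c))
  | join_assoc (a b c) : Eqv (join (join a b) c) (join a (join b c))
  | meet_join (a b) : Eqv (meet a (join a b)) a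
  | join_meet (a b) : Eqv (join a (meet a b)) a
  | distrib (a b c) : Eqv (meet a (join b c)) (join (meet a b) (meet a c))
  | zero_join (a) : Eqv (join zero a) a
  | one_meet (a) : Eqv (meet one a) a
  | disjoint (i) : Eqv (meet (eq0 i) (eq1 i)) zero

/-- Derivable equality as a setoid. -/
def FaceTerm.setoid (V : Type) : Setoid (FaceTerm V) :=
  ⟨FaceTerm.Eqv, FaceTerm.Eqv.refl, FaceTerm.Eqv.symm, FaceTerm.Eqv.trans⟩

/-- The face lattice on the symbols `V`. -/
def FaceLattice (V : Type) : Type := Quotient (FaceTerm.setoid V)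

namespace FaceLattice

variable {V W U : Type}

/-- The class of a face expression. -/
def mk (t : FaceTerm V) : FaceLattice V := Quotient.mk (FaceTerm.setoid V) t

theorem mk_eq {a b : FaceTerm V} (h : FaceTerm.Eqv a b) : mk a = mk b := Quotient.sound h

/-- Meets and joins on classes of expressions. -/
abbrev lattice : Lattice (FaceLattice V) :=
  letI : Max (FaceLattice V) :=
    ⟨Quotient.map₂ FaceTerm.join fun _ _ h _ _ h' => FaceTerm.Eqv.join_congr h h'⟩
  letI : Min (FaceLattice V) :=
    ⟨Quotient.map₂ FaceTerm.meet fun _ _ h _ _ h' => FaceTerm.Eqv.meet_congr h h'⟩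
  Lattice.mk'
    (by rintro ⟨a⟩ ⟨b⟩; exact mk_eq (.join_comm a b))
    (by rintro ⟨a⟩ ⟨b⟩ ⟨c⟩; exact mk_eq (.join_assoc a b c))
    (by rintro ⟨a⟩ ⟨b⟩; exact mk_eq (.meet_comm a b))
    (by rintro ⟨a⟩ ⟨b⟩ ⟨c⟩; exact mk_eq (.meet_assoc a b c))
    (by rintro ⟨a⟩ ⟨b⟩; exact mk_eq (.join_meet a b))
    (by rintro ⟨a⟩ ⟨b⟩; exact mk_eq (.meet_join a b))

instance distribLattice : DistribLattice (FaceLattice V) :=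
  letI := lattice (V := V)
  DistribLattice.ofInfSupLe
    (by rintro ⟨a⟩ ⟨b⟩ ⟨c⟩; exact le_of_eq (mk_eq (.distrib a b c)))

instance boundedOrder : BoundedOrder (FaceLattice V) where
  top := mk FaceTerm.one
  bot := mk FaceTerm.zero
  le_top := by rintro ⟨a⟩; exact inf_eq_right.1 (mk_eq (.one_meet a))
  bot_le := by rintro ⟨a⟩; exact sup_eq_right.1 (mk_eq (.zero_join a))

/-- Evaluation of face expressions, given values of `(i = 0)` and `(i = 1)`. -/
def eval {L : Type*} [DistribLattice L] [BoundedOrder L] (f0 f1 : V → L) : FaceTerm V → L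
  | .eq0 i => f0 i
  | .eq1 i => f1 i
  | .zero => ⊥
  | .one => ⊤
  | .meet a b => eval f0 f1 a ⊓ eval f0 f1 b
  | .join a b => eval f0 f1 a ⊔ eval f0 f1 b

theorem eval_eqv {L : Type*} [DistribLattice L] [BoundedOrder L] (f0 f1 : V → L)
    (hf : ∀ i, f0 i ⊓ f1 i = ⊥) {a b : FaceTerm V} (h : FaceTerm.Eqv a b) :
    eval f0 f1 a = eval f0 f1 b := by
  induction h with
  | refl => rfl
  | symm _ ih => exact ih.symm
  | trans _ _ ih ih' => exact ih.trans ih'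
  | meet_congr _ _ ih ih' => simp only [eval, ih, ih']
  | join_congr _ _ ih ih' => simp only [eval, ih, ih']
  | meet_comm => exact inf_comm _ _
  | join_comm => exact sup_comm _ _
  | meet_assoc => exact inf_assoc _ _ _
  | join_assoc => exact sup_assoc _ _ _
  | meet_join => exact inf_sup_self
  | join_meet => exact sup_inf_self
  | distrib => exact inf_sup_left _ _ _
  | zero_join => exact bot_sup_eq _
  | one_meet => exact top_inf_eq _
  | disjoint i => exact hf i

/-- The lattice homomorphism out of the face lattice induced by its values on generators. -/
def lift {L : Type*} [DistribLattice L] [BoundedOrder L] (f0 f1 : V → L)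
    (hf : ∀ i, f0 i ⊓ f1 i = ⊥) : FaceLattice V → L :=
  Quotient.lift (eval f0 f1) fun _ _ h => eval_eqv f0 f1 hf h

/-- `L × Lᵒᵈ` is a De Morgan algebra, with involution exchanging the two components. -/
instance prodDual (L : Type*) [DistribLattice L] [BoundedOrder L] :
    DeMorganAlgebra (L × Lᵒᵈ) where
  neg p := (OrderDual.ofDual p.2, OrderDual.toDual p.1)
  neg_neg _ := rfl
  neg_inf _ _ := rfl

/-- The pair `((i = 1), (i = 0))`. -/
def gens (i : V) : FaceLattice V × (FaceLattice V)ᵒᵈ :=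
  (mk (.eq1 i), OrderDual.toDual (mk (.eq0 i)))

/-- The map `r ↦ ((r = 1), (r = 0))` on `dM(V)`, determined by its values on generators. -/
def ends : FreeDM V → FaceLattice V × (FaceLattice V)ᵒᵈ := FreeDM.lift gens

/-- The canonical lattice map `dM(V) → F(V)`, `r ↦ (r = 1)`, sending `i` to `(i = 1)` and
`1 - i` to `(i = 0)`. -/
def isOne (r : FreeDM V) : FaceLattice V := (ends r).1

/-- `(r = 0)`, that is `((1 - r) = 1)`. -/
def isZero (r : FreeDM V) : FaceLattice V := isOne (DeMorganAlgebra.neg r)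

theorem isZero_eq (r : FreeDM V) : isZero r = OrderDual.ofDual (ends r).2 := by
  obtain ⟨t⟩ := r
  rfl

theorem ends_eq (r : FreeDM V) : ends r = (isOne r, OrderDual.toDual (isZero r)) := by
  rw [isZero_eq]; rfl

theorem isZero_inf_isOne (r : FreeDM V) : isZero r ⊓ isOne r = ⊥ := by
  have hbot : ∀ a b c d : FaceLattice V, a ⊓ b = ⊥ → c ⊓ d = ⊥ → (a ⊔ c) ⊓ (b ⊓ d) = ⊥ := by
    intro a b c d h h'
    rw [inf_comm, inf_sup_left, inf_assoc, inf_comm d a, ← inf_assoc, inf_comm b a, h, inf_assoc,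
      inf_comm d c, h', bot_inf_eq, inf_bot_eq, sup_bot_eq]
  rw [isZero_eq]
  obtain ⟨t⟩ := r
  change OrderDual.ofDual (ends (FreeDM.mk t)).2 ⊓ (ends (FreeDM.mk t)).1 = (⊥ : FaceLattice V)
  induction t with
  | var i => exact mk_eq (.disjoint i)
  | zero => exact inf_bot_eq _
  | one => exact bot_inf_eq _
  | neg a ih => exact (inf_comm _ _).trans ih
  | meet a b ih ih' => exact hbot _ _ _ _ ih ih'
  | join a b ih ih' =>
    have := hbot _ _ _ _ ((inf_comm _ _).trans ih) ((inf_comm _ _).trans ih')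
    exact (inf_comm _ _).trans this

/-- Substitution on faces: `(i = 0)` goes to `(f i = 0)` and `(i = 1)` to `(f i = 1)`. -/
def subst (f : V → FreeDM W) : FaceLattice V → FaceLattice W :=
  lift (fun i => isZero (f i)) (fun i => isOne (f i)) fun i => isZero_inf_isOne (f i)

theorem subst_var (φ : FaceLattice V) : subst FreeDM.var φ = φ := by
  obtain ⟨t⟩ := φ
  change eval _ _ t = mk t
  induction t with
  | eq0 i => rfl
  | eq1 i => rfl
  | zero => rfl
  | one => rfl
  | meet a b ih ih' => simp only [eval, ih, ih']; rfl
  | join a b ih ih' => simp only [eval, ih, ih']; rfl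

theorem subst_top (f : V → FreeDM W) : subst f ⊤ = ⊤ := rfl

theorem subst_inf (f : V → FreeDM W) (a b : FaceLattice V) :
    subst f (a ⊓ b) = subst f a ⊓ subst f b := by
  obtain ⟨a⟩ := a; obtain ⟨b⟩ := b; rfl

theorem subst_sup (f : V → FreeDM W) (a b : FaceLattice V) :
    subst f (a ⊔ b) = subst f a ⊔ subst f b := by
  obtain ⟨a⟩ := a; obtain ⟨b⟩ := b; rfl

/-- Substitution commutes with `r ↦ ((r = 1), (r = 0))`. -/
theorem ends_subst (f : V → FreeDM W) (r : FreeDM V) :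
    ends (FreeDM.subst f r) =
      (subst f (ends r).1, OrderDual.toDual (subst f (OrderDual.ofDual (ends r).2))) := by
  rw [ends, FreeDM.lift_subst]
  obtain ⟨t⟩ := r
  change FreeDM.eval (fun i => ends (f i)) t = (subst f (FreeDM.eval gens t).1,
    OrderDual.toDual (subst f (OrderDual.ofDual (FreeDM.eval gens t).2)))
  induction t with
  | var i => exact ends_eq (f i)
  | zero => rfl
  | one => rfl
  | neg a ih => simp only [FreeDM.eval, ih]; rfl
  | meet a b ih ih' =>
    rw [FreeDM.eval, ih, ih']
    exact Prod.ext (subst_inf f _ _).symm (congrArg OrderDual.toDual (subst_sup f _ _).symm)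
  | join a b ih ih' =>
    rw [FreeDM.eval, ih, ih']
    exact Prod.ext (subst_sup f _ _).symm (congrArg OrderDual.toDual (subst_inf f _ _).symm)

theorem isOne_subst (f : V → FreeDM W) (r : FreeDM V) :
    isOne (FreeDM.subst f r) = subst f (isOne r) := by
  rw [isOne, ends_subst]; rfl

theorem isZero_subst (f : V → FreeDM W) (r : FreeDM V) :
    isZero (FreeDM.subst f r) = subst f (isZero r) := by
  rw [isZero_eq, isZero_eq, ends_subst]; rfl

theorem subst_subst (f : V → FreeDM W) (g : W → FreeDM U) (φ : FaceLattice V) :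
    subst g (subst f φ) = subst (fun i => FreeDM.subst g (f i)) φ := by
  obtain ⟨t⟩ := φ
  change subst g (eval _ _ t) = eval _ _ t
  induction t with
  | eq0 i => exact (isZero_subst g (f i)).symm
  | eq1 i => exact (isOne_subst g (f i)).symm
  | zero => rfl
  | one => rfl
  | meet a b ih ih' => simp only [eval, subst_inf, ih, ih']
  | join a b ih ih' => simp only [eval, subst_sup, ih, ih']

end FaceLattice

/-! ## Cubical sets and dependent presheaves -/

/-- Objects of the cube category: finite sets of names (natural numbers). -/
structure Cube : Type where
  /-- the finite set of names -/
  names : Finset ℕ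

/-- The names of a cube, as a type. -/
abbrev Cube.Dim (I : Cube) : Type := {i : ℕ // i ∈ I.names}

/-- A map `J ⟶ I` is a function from `I` to the free De Morgan algebra on `J`. -/
instance : Category.{0} Cube where
  Hom J I := I.Dim → FreeDM J.Dim
  id _ := FreeDM.var
  comp g f := fun i => FreeDM.subst g (f i)
  id_comp f := funext fun i => FreeDM.subst_var (f i)
  comp_id _ := rfl
  assoc h g f := funext fun i => (FreeDM.lift_subst g h (f i)).symm

/-- Cubical sets. -/
abbrev CSet := Cubeᵒᵖ ⥤ Type w

/-- The interval: `I ↦ dM(I)`. -/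
def interval : CSet.{0} where
  obj I := FreeDM I.unop.Dim
  map f := ↾(FreeDM.subst f.unop)
  map_id _ := by ext r; exact FreeDM.subst_var r
  map_comp f g := by ext r; exact (FreeDM.lift_subst f.unop g.unop r).symm

/-- The endpoint `0` of the interval. -/
def interval.zero (I : Cubeᵒᵖ) : interval.obj I := (⊥ : FreeDM I.unop.Dim)

/-- The endpoint `1` of the interval. -/
def interval.one (I : Cubeᵒᵖ) : interval.obj I := (⊤ : FreeDM I.unop.Dim)

/-- The cubical set of cofibrant propositions: `I ↦` the face lattice on `I`. -/
def face : CSet.{0} where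
  obj I := FaceLattice I.unop.Dim
  map f := ↾(FaceLattice.subst f.unop)
  map_id _ := by ext φ; exact FaceLattice.subst_var φ
  map_comp f g := by ext φ; exact (FaceLattice.subst_subst f.unop g.unop φ).symm

/-- A cofibrant proposition holds at stage `I` when it is the top element there. The subsingleton
`[φ]` is inhabited at `f : J ⟶ I` exactly when the restriction of `φ` along `f` holds. -/
def Holds {I : Cubeᵒᵖ} (φ : face.obj I) : Prop := φ = (⊤ : FaceLattice I.unop.Dim)

theorem Holds.map {I J : Cubeᵒᵖ} {φ : face.obj I} (h : Holds φ) (f : I ⟶ J) :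
    Holds (face.map f φ) := by
  subst h; rfl

/-- Types in context `Γ`, that is dependent presheaves over `Γ`: presheaves on the category of
elements of `Γ`. In Mathlib's `Γ.Elements`, a morphism `(I, ρ) ⟶ (J, ρ')` is an `f : J ⟶ I` in the
cube category with `ρ f = ρ'`, so a presheaf is a covariant functor on `Γ.Elements`. -/
abbrev Ty (Γ : CSet.{w}) := Γ.Elements ⥤ Type v

/-- Substitution `Aσ` of a dependent presheaf `A` along `σ : Δ ⟶ Γ`. -/
abbrev Ty.reindex {Δ Γ : CSet.{w}} (σ : Δ ⟶ Γ) (A : Ty.{w, v} Γ) : Ty.{w, v} Δ :=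
  CategoryOfElements.map σ ⋙ A

/-- The restriction `(J, ρ f)` of `e = (I, ρ)` along `f`. -/
abbrev res {Γ : CSet.{w}} (e : Γ.Elements) {J : Cubeᵒᵖ} (f : e.1 ⟶ J) : Γ.Elements :=
  ⟨J, Γ.map f e.2⟩

/-- The morphism from `e` to its restriction. -/
abbrev toRes {Γ : CSet.{w}} (e : Γ.Elements) {J : Cubeᵒᵖ} (f : e.1 ⟶ J) : e ⟶ res e f :=
  ⟨f, rfl⟩

/-! ## Homogeneous composition -/

/-- A partial path `u : [φ] → A^𝕀` at `e = (I, ρ)`: a compatible family of elements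
`u_{f,r} ∈ A(J, ρ f)` for `f : J ⟶ I` with `φ f = 1` and `r ∈ 𝕀(J)`. -/
structure PartialPath {Γ : CSet.{w}} (A : Ty.{w, v} Γ) (e : Γ.Elements) (φ : face.obj e.1) where
  /-- the element `u_{f,r}` -/
  val : ∀ {e' : Γ.Elements} (f : e ⟶ e'), Holds (face.map f.val φ) → interval.obj e'.1 → A.obj e'
  natural : ∀ {e' e'' : Γ.Elements} (f : e ⟶ e') (g : e' ⟶ e'')
    (h : Holds (face.map f.val φ)) (h' : Holds (face.map (f ≫ g).val φ)) (r : interval.obj e'.1),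
    A.map g (val f h r) = val (f ≫ g) h' (interval.map g.val r)

namespace PartialPath

variable {Γ : CSet.{w}} {A B : Ty.{w, v} Γ} {e : Γ.Elements} {φ : face.obj e.1}

@[ext]
theorem ext' {u u' : PartialPath A e φ}
    (h : ∀ {e' : Γ.Elements} (f : e ⟶ e') (hf : Holds (face.map f.val φ)) (r : interval.obj e'.1),
      u.val f hf r = u'.val f hf r) : u = u' := by
  cases u; cases u'
  congr
  funext e' f hf r
  exact h f hf r

theorem holds_comp {e' e'' : Γ.Elements} {f : e ⟶ e'} {g : e' ⟶ e''}
    (h : Holds (face.map g.val (face.map f.val φ))) : Holds (face.map (f ≫ g).val φ) := by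
  simpa using h

/-- The restriction `u f⁺`, with `(u f⁺)_{g,r} = u_{fg,r}`. -/
def restrict {e' : Γ.Elements} (u : PartialPath A e φ) (f : e ⟶ e') :
    PartialPath A e' (face.map f.val φ) where
  val g h r := u.val (f ≫ g) (holds_comp h) r
  natural g k h h' r := by
    have := u.natural (f ≫ g) k (holds_comp h) (by simpa using holds_comp h') r
    simp only [this, Category.assoc]

/-- The image of a partial path under a map of types. -/
def map (α : A ⟶ B) (u : PartialPath A e φ) : PartialPath B e φ where
  val f h r := α.app _ (u.val f h r)
  natural f g h h' r := by
    rw [← u.natural f g h h' r, NatTrans.naturality_apply]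

/-- The condition `φ ⇒ u 0 = u₀`. -/
def StartsAt (u : PartialPath A e φ) (u₀ : A.obj e) : Prop :=
  ∀ {e' : Γ.Elements} (f : e ⟶ e') (h : Holds (face.map f.val φ)),
    u.val f h (interval.zero e'.1) = A.map f u₀

theorem StartsAt.restrict {u : PartialPath A e φ} {u₀ : A.obj e} (h : u.StartsAt u₀)
    {e' : Γ.Elements} (f : e ⟶ e') : (u.restrict f).StartsAt (A.map f u₀) := by
  intro e'' g hg
  refine (h (f ≫ g) (holds_comp hg)).trans ?_
  simp

theorem StartsAt.map {u : PartialPath A e φ} {u₀ : A.obj e} (h : u.StartsAt u₀)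
    (α : A ⟶ B) : (u.map α).StartsAt (α.app e u₀) := by
  intro e' f hf
  refine (congrArg (α.app e') (h f hf)).trans ?_
  rw [NatTrans.naturality_apply]

end PartialPath

/-- A homogeneous composition structure on `A` over `Γ`, i.e. an element of `Π (ρ : Γ) Fib(A ρ)`;
over the unit context this is a fibrancy structure on a cubical set. -/
@[ext]
structure HComp {Γ : CSet.{w}} (A : Ty.{w, v} Γ) where
  /-- the operation sending `φ, u, u₀` to `u₁` -/
  comp : ∀ {e : Γ.Elements} (φ : face.obj e.1) (u : PartialPath A e φ) (u₀ : A.obj e),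
    u.StartsAt u₀ → A.obj e
  /-- `φ ⇒ u 1 = u₁` -/
  extends_one : ∀ {e : Γ.Elements} (φ : face.obj e.1) (u : PartialPath A e φ) (u₀ : A.obj e)
    (h₀ : u.StartsAt u₀) {e' : Γ.Elements} (f : e ⟶ e') (h : Holds (face.map f.val φ)),
    u.val f h (interval.one e'.1) = A.map f (comp φ u u₀ h₀)
  natural : ∀ {e : Γ.Elements} (φ : face.obj e.1) (u : PartialPath A e φ) (u₀ : A.obj e)
    (h₀ : u.StartsAt u₀) {e' : Γ.Elements} (f : e ⟶ e'),
    A.map f (comp φ u u₀ h₀) =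
      comp (face.map f.val φ) (u.restrict f) (A.map f u₀) (h₀.restrict f)

/-- A map of types is fibrancy preserving if it commutes with the composition operations. -/
def HComp.Preserves {Γ : CSet.{w}} {A B : Ty.{w, v} Γ} (hA : HComp A) (hB : HComp B)
    (α : A ⟶ B) : Prop :=
  ∀ {e : Γ.Elements} (φ : face.obj e.1) (u : PartialPath A e φ) (u₀ : A.obj e)
    (h₀ : u.StartsAt u₀),
    α.app e (hA.comp φ u u₀ h₀) = hB.comp φ (u.map α) (α.app e u₀) (h₀.map α)

section Reindex

variable {Δ Γ : CSet.{w}} (σ : Δ ⟶ Γ) {A : Ty.{w, v} Γ}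

/-- The identification of `σ (ρ f)` with `(σ ρ) f`. -/
def resIso {e : Δ.Elements} {e' : Γ.Elements} (f : (CategoryOfElements.map σ).obj e ⟶ e') :
    (CategoryOfElements.map σ).obj (res e f.val) ⟶ e' :=
  ⟨𝟙 _, by
    have h : (Γ.map f.val) (σ.app e.1 e.2) = e'.2 := f.property
    have h' : σ.app e'.1 (Δ.map f.val e.2) = e'.2 :=
      (NatTrans.naturality_apply σ f.val e.2).trans h
    exact (Functor.map_id_apply Γ _ _).trans h'⟩

theorem map_toRes_resIso {e : Δ.Elements} {e' : Γ.Elements}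
    (f : (CategoryOfElements.map σ).obj e ⟶ e') :
    (CategoryOfElements.map σ).map (toRes e f.val) ≫ resIso σ f = f :=
  CategoryOfElements.ext _ _ _ (Category.comp_id _)

/-- A partial path of `Aσ` at `ρ`, regarded as a partial path of `A` at `σ ρ`. -/
def PartialPath.push {e : Δ.Elements} {φ : face.obj e.1} (u : PartialPath (A.reindex σ) e φ) :
    PartialPath A ((CategoryOfElements.map σ).obj e) φ where
  val f h r := A.map (resIso σ f) (u.val (toRes e f.val) h r)
  natural {e' e''} f g h h' r := by
    let k : res e f.val ⟶ res e (f ≫ g).val := ⟨g.val, (Functor.map_comp_apply Δ _ _ _).symm⟩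
    have := u.natural (toRes e f.val) k h h' r
    refine Eq.trans ?_ (congrArg (A.map (resIso σ (f ≫ g))) this)
    change _ = A.map _ (A.map ((CategoryOfElements.map σ).map k) _)
    rw [← Functor.map_comp_apply, ← Functor.map_comp_apply]
    have hk : resIso σ f ≫ g = (CategoryOfElements.map σ).map k ≫ resIso σ (f ≫ g) :=
      CategoryOfElements.ext _ _ _ ((Category.id_comp _).trans (Category.comp_id _).symm)
    rw [hk]

theorem PartialPath.val_congr {e e' : Γ.Elements} {φ : face.obj e.1} (u : PartialPath A e φ)
    {f g : e ⟶ e'} (hfg : f = g) (h : Holds (face.map f.val φ)) (h' : Holds (face.map g.val φ))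
    {r r' : interval.obj e'.1} (hr : r = r') : u.val f h r = u.val g h' r' := by
  subst hfg; subst hr; rfl

theorem PartialPath.push_val {e e' : Δ.Elements} {φ : face.obj e.1}
    (u : PartialPath (A.reindex σ) e φ) (f : e ⟶ e') (h : Holds (face.map f.val φ))
    (r : interval.obj e'.1) :
    (u.push σ).val ((CategoryOfElements.map σ).map f) h r = u.val f h r := by
  let k : res e f.val ⟶ e' := ⟨𝟙 _, (Functor.map_id_apply Δ _ _).trans f.property⟩
  have hk : toRes e f.val ≫ k = f := CategoryOfElements.ext _ _ _ (Category.comp_id _)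
  have := u.natural (toRes e f.val) k h (by rw [hk]; exact h) r
  exact this.trans (u.val_congr hk _ _ (Functor.map_id_apply interval _ _))

theorem PartialPath.push_restrict {e e' : Δ.Elements} {φ : face.obj e.1}
    (u : PartialPath (A.reindex σ) e φ) (f : e ⟶ e') :
    (u.restrict f).push σ = (u.push σ).restrict ((CategoryOfElements.map σ).map f) := by
  ext e'' g hg r
  let p : e ⟶ res e' g.val := f ≫ toRes e' g.val
  have hp : (CategoryOfElements.map σ).map p ≫ resIso σ g =
      (CategoryOfElements.map σ).map f ≫ g := by
    rw [Functor.map_comp, Category.assoc, map_toRes_resIso]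
  have hφ : Holds (face.map p.val φ) := PartialPath.holds_comp (f := f) (g := toRes e' g.val) hg
  have hφ' : Holds (face.map ((CategoryOfElements.map σ).map p ≫ resIso σ g).val φ) := by
    rw [hp]
    exact PartialPath.holds_comp (f := (CategoryOfElements.map σ).map f) hg
  have h₁ := u.push_val σ p hφ r
  have h₂ := (u.push σ).natural ((CategoryOfElements.map σ).map p) (resIso σ g) hφ hφ' r
  refine (congrArg (A.map (resIso σ g)) h₁).symm.trans (h₂.trans ?_)
  exact (u.push σ).val_congr hp _ _ (Functor.map_id_apply interval _ _)

theorem PartialPath.StartsAt.push {e : Δ.Elements} {φ : face.obj e.1}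
    {u : PartialPath (A.reindex σ) e φ} {u₀ : (A.reindex σ).obj e} (h : u.StartsAt u₀) :
    (u.push σ).StartsAt (A := A) u₀ := by
  intro e' f hf
  refine (congrArg (A.map (resIso σ f)) (h (toRes e f.val) hf)).trans ?_
  change A.map _ (A.map ((CategoryOfElements.map σ).map _) _) = _
  rw [← Functor.map_comp_apply, map_toRes_resIso]

/-- Substitution in homogeneous composition structures. -/
def HComp.reindex (H : HComp A) : HComp (A.reindex σ) where
  comp φ u u₀ h₀ := H.comp (e := (CategoryOfElements.map σ).obj _) φ (u.push σ) u₀ (h₀.push σ)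
  extends_one φ u u₀ h₀ e' f h := by
    rw [← u.push_val σ f h]
    exact H.extends_one (e := (CategoryOfElements.map σ).obj _) φ (u.push σ) u₀ (h₀.push σ)
      ((CategoryOfElements.map σ).map f) h
  natural φ u u₀ h₀ e' f := by
    refine (H.natural (e := (CategoryOfElements.map σ).obj _) φ (u.push σ) u₀ (h₀.push σ)
      ((CategoryOfElements.map σ).map f)).trans ?_
    simp only [PartialPath.push_restrict]
    rfl

end Reindex

/-! ## Points and families of paths -/

/-- An element of `A` in context `Γ`. -/
@[ext]
structure Point {Γ : CSet.{w}} (A : Ty.{w, v} Γ) where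
  /-- the value at each stage -/
  val : ∀ e : Γ.Elements, A.obj e
  natural : ∀ {e e' : Γ.Elements} (f : e ⟶ e'), A.map f (val e) = val e'

/-- A family of paths `X → A^𝕀` over `Γ`, written as a natural operation `X × 𝕀 → A`. -/
@[ext]
structure PathFamily {Γ : CSet.{w}} (X A : Ty.{w, v} Γ) where
  /-- the value at `x` and `r` -/
  val : ∀ {e : Γ.Elements}, X.obj e → interval.obj e.1 → A.obj e
  natural : ∀ {e e' : Γ.Elements} (f : e ⟶ e') (x : X.obj e) (r : interval.obj e.1),
    A.map f (val x r) = val (X.map f x) (interval.map f.val r)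

/-- Substitution in elements. -/
def Point.reindex {Δ Γ : CSet.{w}} (σ : Δ ⟶ Γ) {A : Ty.{w, v} Γ} (a : Point A) :
    Point (A.reindex σ) where
  val e := a.val ((CategoryOfElements.map σ).obj e)
  natural f := a.natural ((CategoryOfElements.map σ).map f)

/-- Substitution in families of paths. -/
def PathFamily.reindex {Δ Γ : CSet.{w}} (σ : Δ ⟶ Γ) {X A : Ty.{w, v} Γ} (l : PathFamily X A) :
    PathFamily (X.reindex σ) (A.reindex σ) where
  val {e} x r := l.val (e := (CategoryOfElements.map σ).obj e) x r
  natural f x r := l.natural ((CategoryOfElements.map σ).map f) x r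

/-! ## Suspension algebras -/

/-- A `ΣX`-algebra over `Γ`. -/
structure SuspAlgebra {Γ : CSet.{w}} (X : Ty.{w, v} Γ) where
  /-- the underlying type -/
  carrier : Ty.{w, v} Γ
  /-- the homogeneous composition structure -/
  hcomp : HComp carrier
  /-- the north pole `N` -/
  north : Point carrier
  /-- the south pole `S` -/
  south : Point carrier
  /-- the meridians -/
  merid : PathFamily X carrier
  merid_zero : ∀ {e : Γ.Elements} (x : X.obj e), merid.val x (interval.zero e.1) = north.val e
  merid_one : ∀ {e : Γ.Elements} (x : X.obj e), merid.val x (interval.one e.1) = south.val e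

namespace SuspAlgebra

/-- Maps of `ΣX`-algebras. -/
@[ext]
structure Hom {Γ : CSet.{w}} {X : Ty.{w, v} Γ} (S T : SuspAlgebra X) where
  /-- the underlying map of types -/
  map : S.carrier ⟶ T.carrier
  preserves : S.hcomp.Preserves T.hcomp map
  map_north : ∀ e : Γ.Elements, map.app e (S.north.val e) = T.north.val e
  map_south : ∀ e : Γ.Elements, map.app e (S.south.val e) = T.south.val e
  map_merid : ∀ {e : Γ.Elements} (x : X.obj e) (r : interval.obj e.1),
    map.app e (S.merid.val x r) = T.merid.val x r

/-- The category of `ΣX`-algebras. -/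
instance {Γ : CSet.{w}} (X : Ty.{w, v} Γ) : Category (SuspAlgebra X) where
  Hom := Hom
  id S :=
    { map := 𝟙 _
      preserves := fun _ _ _ _ => rfl
      map_north := fun _ => rfl
      map_south := fun _ => rfl
      map_merid := fun _ _ => rfl }
  comp α β :=
    { map := α.map ≫ β.map
      preserves := fun φ u u₀ h₀ => by
        simp only [NatTrans.comp_app_apply, α.preserves φ u u₀ h₀]
        exact β.preserves φ (u.map α.map) _ (h₀.map α.map)
      map_north := fun e => by simp [α.map_north, β.map_north]
      map_south := fun e => by simp [α.map_south, β.map_south]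
      map_merid := fun x r => by simp [α.map_merid, β.map_merid] }

/-- Substitution in `ΣX`-algebras. -/
def reindex {Δ Γ : CSet.{w}} (σ : Δ ⟶ Γ) {X : Ty.{w, v} Γ} (S : SuspAlgebra X) :
    SuspAlgebra (X.reindex σ) where
  carrier := S.carrier.reindex σ
  hcomp := S.hcomp.reindex σ
  north := S.north.reindex σ
  south := S.south.reindex σ
  merid := S.merid.reindex σ
  merid_zero {e} x := S.merid_zero (e := (CategoryOfElements.map σ).obj e) x
  merid_one {e} x := S.merid_one (e := (CategoryOfElements.map σ).obj e) x

end SuspAlgebra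

/-! ## Pushout algebras -/

/-- A span of types over `Γ`. -/
structure TySpan (Γ : CSet.{w}) where
  /-- the apex -/
  C : Ty.{w, v} Γ
  /-- the left foot -/
  A : Ty.{w, v} Γ
  /-- the right foot -/
  B : Ty.{w, v} Γ
  /-- the left leg -/
  u : C ⟶ A
  /-- the right leg -/
  v : C ⟶ B

/-- Substitution in spans. -/
def TySpan.reindex {Δ Γ : CSet.{w}} (σ : Δ ⟶ Γ) (D : TySpan.{w, v} Γ) : TySpan.{w, v} Δ where
  C := D.C.reindex σ
  A := D.A.reindex σ
  B := D.B.reindex σ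
  u := Functor.whiskerLeft (CategoryOfElements.map σ) D.u
  v := Functor.whiskerLeft (CategoryOfElements.map σ) D.v

/-- A `D`-algebra over `Γ`, for a span `D = (C, A, B, u, v)` over `Γ`. -/
structure PushoutAlgebra {Γ : CSet.{w}} (D : TySpan.{w, v} Γ) where
  /-- the underlying type -/
  carrier : Ty.{w, v} Γ
  /-- the homogeneous composition structure -/
  hcomp : HComp carrier
  /-- the left inclusion -/
  inl : D.A ⟶ carrier
  /-- the right inclusion -/
  inr : D.B ⟶ carrier
  /-- the gluing paths -/
  push : PathFamily D.C carrier
  push_zero : ∀ {e : Γ.Elements} (c : D.C.obj e),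
    push.val c (interval.zero e.1) = inl.app e (D.u.app e c)
  push_one : ∀ {e : Γ.Elements} (c : D.C.obj e),
    push.val c (interval.one e.1) = inr.app e (D.v.app e c)

namespace PushoutAlgebra

/-- Maps of `D`-algebras. -/
@[ext]
structure Hom {Γ : CSet.{w}} {D : TySpan.{w, v} Γ} (S T : PushoutAlgebra D) where
  /-- the underlying map of types -/
  map : S.carrier ⟶ T.carrier
  preserves : S.hcomp.Preserves T.hcomp map
  map_inl : ∀ {e : Γ.Elements} (a : D.A.obj e), map.app e (S.inl.app e a) = T.inl.app e a
  map_inr : ∀ {e : Γ.Elements} (b : D.B.obj e), map.app e (S.inr.app e b) = T.inr.app e b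
  map_push : ∀ {e : Γ.Elements} (c : D.C.obj e) (r : interval.obj e.1),
    map.app e (S.push.val c r) = T.push.val c r

/-- The category of `D`-algebras. -/
instance {Γ : CSet.{w}} (D : TySpan.{w, v} Γ) : Category (PushoutAlgebra D) where
  Hom := Hom
  id S :=
    { map := 𝟙 _
      preserves := fun _ _ _ _ => rfl
      map_inl := fun _ => rfl
      map_inr := fun _ => rfl
      map_push := fun _ _ => rfl }
  comp α β :=
    { map := α.map ≫ β.map
      preserves := fun φ u u₀ h₀ => by
        simp only [NatTrans.comp_app_apply, α.preserves φ u u₀ h₀]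
        exact β.preserves φ (u.map α.map) _ (h₀.map α.map)
      map_inl := fun a => by simp [α.map_inl, β.map_inl]
      map_inr := fun b => by simp [α.map_inr, β.map_inr]
      map_push := fun c r => by simp [α.map_push, β.map_push] }

/-- Substitution in `D`-algebras. -/
def reindex {Δ Γ : CSet.{w}} (σ : Δ ⟶ Γ) {D : TySpan.{w, v} Γ} (S : PushoutAlgebra D) :
    PushoutAlgebra (D.reindex σ) where
  carrier := S.carrier.reindex σ
  hcomp := S.hcomp.reindex σ
  inl := Functor.whiskerLeft (CategoryOfElements.map σ) S.inl
  inr := Functor.whiskerLeft (CategoryOfElements.map σ) S.inr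
  push := S.push.reindex σ
  push_zero {e} c := S.push_zero (e := (CategoryOfElements.map σ).obj e) c
  push_one {e} c := S.push_one (e := (CategoryOfElements.map σ).obj e) c

end PushoutAlgebra

end CubicalSets

/-!
# Initial suspension and pushout algebras, strictly stable under substitution

Formal expressions are generated by the two inclusions, the interior points of the gluing paths and
formal compositions `hcomp φ u u₀` with `φ ≠ 1`. Restriction of such pre-terms is defined by
recursion: `hcomp φ u u₀` restricts along `f` to `u_{f,1}` if `φ f = 1`, and to a formal composition
otherwise. As the tubes `u` are arbitrary families, this is not functorial. It is functorial on the
coherent pre-terms, those whose tubes are hereditarily natural and start at their bases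
(`PreTerm.Coherent.restrict_restrict`), and restriction preserves coherence
(`PreTerm.Coherent.restrict`). The coherent pre-terms form an algebra (`freeAlgebra`).
A coherent pre-term is evaluated in any algebra by recursion; naturality of the evaluation
(`elim_restrict`) is proved by induction, and shows at the same time that the compositions used in
it are legitimate. Uniqueness is again an induction (`hom_app_eq_elim`), so the algebra is initial.

Strict stability is obtained from a universe. The spans over the representables form a cubical set
`spanUniverse`, in the manner of Hofmann and Streicher, which carries a generic span. Every span `D`
over `Γ` is equal to the substitution of the generic span along a map `nameSpan D : Γ → U`, and
naming commutes with substitution on the nose. Pre-terms are therefore only built over `U`, and the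
pushout of `D` at `ρ` consists of the coherent pre-terms over `nameSpan D ρ`. Hence it depends
on `nameSpan D ρ` only, and substitution along `σ` replaces `nameSpan D` by its composite
with `σ` (`freeAlgebra_reindex`). The universe `U` lies in a larger universe level than the types
it classifies, and possibly than `Γ`, so maps into it are encoded by `Code`, and pre-terms over `U`
are arranged so as not to quantify over elements of `U`.

Suspensions are the pushouts of the spans `1 ← X → 1`.
-/

universe u

namespace CubicalSets

/-! ### Pre-terms -/

/-- To treat all morphisms out of `e` in the category of elements it suffices to treat the
restrictions `toRes e f`; this removes the equation that a morphism `e ⟶ e'` carries. -/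
@[elab_as_elim]
def homCases {Γ : CSet.{w}} {e : Γ.Elements} {M : ∀ {e' : Γ.Elements}, (e ⟶ e') → Sort*}
    (h : ∀ (J : Cubeᵒᵖ) (f : e.1 ⟶ J), M (toRes e f)) {e' : Γ.Elements} (f : e ⟶ e') : M f :=
  have aux : ∀ (ρ : Γ.obj e'.1) (hρ : Γ.map f.val e.2 = ρ),
      M (e' := ⟨e'.1, ρ⟩) ⟨f.val, hρ⟩ := by
    rintro _ rfl
    exact h _ f.val
  aux e'.2 f.property

/-- The shapes of formal terms at a stage `I`: what is left of a term when the elements of the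
span that label its leaves are forgotten. -/
inductive Shape : Cubeᵒᵖ → Type
  | inl {I : Cubeᵒᵖ} : Shape I
  | inr {I : Cubeᵒᵖ} : Shape I
  | push {I : Cubeᵒᵖ} (r : interval.obj I) (h₀ : r ≠ interval.zero I)
      (h₁ : r ≠ interval.one I) : Shape I
  | hcomp {I : Cubeᵒᵖ} (φ : face.obj I) (hφ : ¬ Holds φ)
      (s : ∀ {J : Cubeᵒᵖ} (f : I ⟶ J), Holds (face.map f φ) → interval.obj J → Shape J)
      (s₀ : Shape I) : Shape I

section PreTerms

variable {U : CSet.{w}} (D : TySpan.{w, v} U)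

/-- The labellings over `ρ ∈ U(I)` of the leaves of a shape. -/
def Label : ∀ {I : Cubeᵒᵖ}, Shape I → U.obj I → Type v
  | I, .inl, ρ => D.A.obj ⟨I, ρ⟩
  | I, .inr, ρ => D.B.obj ⟨I, ρ⟩
  | I, .push _ _ _, ρ => D.C.obj ⟨I, ρ⟩
  | I, .hcomp φ _ s s₀, ρ =>
    (∀ (J : Cubeᵒᵖ) (f : I ⟶ J) (h : Holds (face.map f φ)) (r : interval.obj J),
      Label (s f h r) (U.map f ρ)) × Label s₀ ρ

/-- Pre-terms over `e = (I, ρ)`: formal expressions built from the elements of the span and formal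
compositions with a tube on a proposition different from `1`, with no compatibility required. They
would form an inductive family indexed by `U.Elements`, which is too large an index for the values
to stay in `Type v`; the family of shapes is indexed by the small category of cubes, and labels are
added by recursion. -/
def PreTerm (e : U.Elements) : Type v := Σ s : Shape e.1, Label D s e.2

/-- A family of pre-terms `u_{f,r}` with the indexing of a partial path, not necessarily natural.
It is indexed by all morphisms `e ⟶ e'`; by `PreTerm.extend` this amounts to the small family
that a label stores. -/
abbrev PreTube (e : U.Elements) (φ : face.obj e.1) : Type _ :=
  ∀ (e' : U.Elements) (f : e ⟶ e'), Holds (face.map f.val φ) → interval.obj e'.1 → PreTerm D e'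

variable {D}

namespace PreTerm

/-- The formal left inclusion. -/
def inl {e : U.Elements} (a : D.A.obj e) : PreTerm D e := ⟨.inl, a⟩

/-- The formal right inclusion. -/
def inr {e : U.Elements} (b : D.B.obj e) : PreTerm D e := ⟨.inr, b⟩

/-- A formal point in the interior of a gluing path; at the endpoints such points are
inclusions, see `glue`. -/
def push {e : U.Elements} (c : D.C.obj e) (r : interval.obj e.1) (h₀ : r ≠ interval.zero e.1)
    (h₁ : r ≠ interval.one e.1) : PreTerm D e := ⟨.push r h₀ h₁, c⟩

/-- A formal composition. Only propositions `φ ≠ 1` occur: for `φ = 1` the composite has to be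
equal to `u_{1,1}`. -/
def hcomp {e : U.Elements} (φ : face.obj e.1) (hφ : ¬ Holds φ) (u : PreTube D e φ)
    (u₀ : PreTerm D e) : PreTerm D e :=
  ⟨.hcomp φ hφ (fun f h r => (u _ (toRes e f) h r).1) u₀.1,
    (fun _ f h r => (u _ (toRes e f) h r).2, u₀.2)⟩

/-- Extension of a family given on the morphisms `toRes e f` to all morphisms out of `e`. -/
def extend {e : U.Elements} {φ : face.obj e.1}
    (u : ∀ (J : Cubeᵒᵖ) (f : e.1 ⟶ J), Holds (face.map f φ) → interval.obj J →
      PreTerm D (res e f)) : PreTube D e φ :=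
  fun e' f h r => (show res e f.val = e' from Sigma.ext rfl (heq_of_eq f.property)) ▸
    u e'.1 f.val h r

theorem extend_toRes {e : U.Elements} {φ : face.obj e.1} (u : PreTube D e φ) :
    extend (fun _ f h r => u _ (toRes e f) h r) = u := by
  funext e' f
  refine homCases ?_ f
  intros
  rfl

theorem hcomp_congr {e : U.Elements} {φ φ' : face.obj e.1} (hφ : ¬ Holds φ) (hφ' : ¬ Holds φ')
    {u : PreTube D e φ} {u' : PreTube D e φ'} {u₀ u₀' : PreTerm D e} (h : φ = φ')
    (hu : ∀ (e' : U.Elements) (f : e ⟶ e') (hf : Holds (face.map f.val φ))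
      (hf' : Holds (face.map f.val φ')) (r : interval.obj e'.1), u e' f hf r = u' e' f hf' r)
    (h₀ : u₀ = u₀') : hcomp φ hφ u u₀ = hcomp φ' hφ' u' u₀' := by
  subst h h₀
  have : u = u' := by
    funext e' f hf r
    exact hu e' f hf hf r
  rw [this]

theorem tube_congr {e e' : U.Elements} {φ : face.obj e.1} (u : PreTube D e φ)
    {f g : e ⟶ e'} (hfg : f = g) (h : Holds (face.map f.val φ)) (h' : Holds (face.map g.val φ))
    {r r' : interval.obj e'.1} (hr : r = r') : u e' f h r = u e' g h' r' := by
  subst hfg hr; rfl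

section Recursion

variable {M : ∀ e : U.Elements, PreTerm D e → Sort*}
  (inl' : ∀ (e : U.Elements) (a : D.A.obj e), M e (inl a))
  (inr' : ∀ (e : U.Elements) (b : D.B.obj e), M e (inr b))
  (push' : ∀ (e : U.Elements) (c : D.C.obj e) (r : interval.obj e.1)
    (h₀ : r ≠ interval.zero e.1) (h₁ : r ≠ interval.one e.1), M e (push c r h₀ h₁))
  (hcomp' : ∀ (e : U.Elements) (φ : face.obj e.1) (hφ : ¬ Holds φ) (u : PreTube D e φ)
    (u₀ : PreTerm D e),
    (∀ (e' : U.Elements) (f : e ⟶ e') (h : Holds (face.map f.val φ)) (r : interval.obj e'.1),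
      M e' (u e' f h r)) → M e u₀ → M e (hcomp φ hφ u u₀))

/-- The recursion behind `recOn'` and `iter`, on shapes. -/
def recAux : ∀ {I : Cubeᵒᵖ} (s : Shape I) (ρ : U.obj I) (l : Label D s ρ), M ⟨I, ρ⟩ ⟨s, l⟩
  | I, .inl, ρ, l => inl' ⟨I, ρ⟩ l
  | I, .inr, ρ, l => inr' ⟨I, ρ⟩ l
  | I, .push r h₀ h₁, ρ, l => push' ⟨I, ρ⟩ l r h₀ h₁
  | I, .hcomp φ hφ s s₀, ρ, l =>
    hcomp' ⟨I, ρ⟩ φ hφ (extend fun _ f h r => ⟨s f h r, l.1 _ f h r⟩) ⟨s₀, l.2⟩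
      (fun _ f => homCases (fun _ f h r => recAux (s f h r) (U.map f ρ) (l.1 _ f h r)) f)
      (recAux s₀ ρ l.2)

/-- The dependent recursor of pre-terms, as if they were an inductive family. -/
@[elab_as_elim]
def recOn' {e : U.Elements} (t : PreTerm D e) : M e t :=
  recAux inl' inr' push' hcomp' t.1 e.2 t.2

end Recursion

section Iteration
variable {M : U.Elements → Sort*}
  (inl' : ∀ (e : U.Elements), D.A.obj e → M e)
  (inr' : ∀ (e : U.Elements), D.B.obj e → M e)
  (push' : ∀ (e : U.Elements) (_ : D.C.obj e) (r : interval.obj e.1)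
    (_ : r ≠ interval.zero e.1) (_ : r ≠ interval.one e.1), M e)
  (hcomp' : ∀ (e : U.Elements) (φ : face.obj e.1) (_ : ¬ Holds φ) (_ : PreTube D e φ)
    (_ : PreTerm D e),
    (∀ (e' : U.Elements) (f : e ⟶ e') (_ : Holds (face.map f.val φ)) (_ : interval.obj e'.1),
      M e') → M e → M e)

/-- The non-dependent recursor of pre-terms. On `inl`, `inr` and `push` it computes by definition;
see `iter_hcomp` for formal compositions. -/
def iter {e : U.Elements} (t : PreTerm D e) : M e :=
  recAux (M := fun e _ => M e) inl' inr' push' hcomp' t.1 e.2 t.2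

theorem iter_hcomp {e : U.Elements} (φ : face.obj e.1) (hφ : ¬ Holds φ) (u : PreTube D e φ)
    (u₀ : PreTerm D e) : iter inl' inr' push' hcomp' (hcomp φ hφ u u₀) =
      hcomp' e φ hφ u u₀ (fun _ f h r => iter inl' inr' push' hcomp' (u _ f h r))
        (iter inl' inr' push' hcomp' u₀) := by
  -- By definition the left side is `hcomp'` at the extension of the small family stored in the
  -- label of `hcomp φ hφ u u₀`, which is propositionally equal to `u`.
  have key : ∀ (u' : PreTube D e φ)
      (k : ∀ (e' : U.Elements) (f : e ⟶ e') (_ : Holds (face.map f.val φ))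
        (_ : interval.obj e'.1), M e'), u' = u →
      (k = fun _ f h r => iter inl' inr' push' hcomp' (u' _ f h r)) →
      hcomp' e φ hφ u' u₀ k (iter inl' inr' push' hcomp' u₀) =
        hcomp' e φ hφ u u₀ (fun _ f h r => iter inl' inr' push' hcomp' (u _ f h r))
          (iter inl' inr' push' hcomp' u₀) := by
    rintro _ _ rfl rfl
    rfl
  refine key _ _ (extend_toRes u) ?_
  funext e' f
  refine homCases ?_ f
  intros
  rfl

end Iteration

attribute [irreducible] hcomp

end PreTerm

end PreTerms

/-! ### Restriction and coherence of pre-terms -/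

theorem interval.zero_ne_one (I : Cubeᵒᵖ) : interval.zero I ≠ interval.one I := by
  intro h
  have h' := congrArg (FreeDM.lift (α := Bool × Boolᵒᵈ) fun _ => ⊥) h
  exact absurd (congrArg Prod.fst h') Bool.false_ne_true

theorem face_map_comp {Γ : CSet.{w}} {e e' e'' : Γ.Elements} (f : e ⟶ e') (g : e' ⟶ e'')
    (φ : face.obj e.1) : face.map g.val (face.map f.val φ) = face.map (f ≫ g).val φ := by
  simp

theorem interval_map_comp {Γ : CSet.{w}} {e e' e'' : Γ.Elements} (f : e ⟶ e') (g : e' ⟶ e'')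
    (r : interval.obj e.1) :
    interval.map g.val (interval.map f.val r) = interval.map (f ≫ g).val r := by
  simp

section Coherence

variable {U : CSet.{w}} {D : TySpan.{w, v} U}

namespace PreTerm

open Classical in
/-- The point at `r` on the formal gluing path of `c`; at the endpoints it is an inclusion. -/
noncomputable def glue {e : U.Elements} (c : D.C.obj e) (r : interval.obj e.1) : PreTerm D e :=
  if h₀ : r = interval.zero e.1 then inl (D.u.app e c)
  else if h₁ : r = interval.one e.1 then inr (D.v.app e c)
  else push c r h₀ h₁

theorem glue_zero {e : U.Elements} (c : D.C.obj e) :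
    glue c (interval.zero e.1) = inl (D.u.app e c) := dif_pos rfl

theorem glue_one {e : U.Elements} (c : D.C.obj e) :
    glue c (interval.one e.1) = inr (D.v.app e c) := by
  rw [glue, dif_neg (interval.zero_ne_one e.1).symm, dif_pos rfl]

theorem glue_eq_push {e : U.Elements} (c : D.C.obj e) {r : interval.obj e.1}
    (h₀ : r ≠ interval.zero e.1) (h₁ : r ≠ interval.one e.1) : glue c r = push c r h₀ h₁ := by
  rw [glue, dif_neg h₀, dif_neg h₁]

/-- The family `u f⁺`, with `(u f⁺)_{g,r} = u_{fg,r}`. -/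
def reindexTube {e e' : U.Elements} {φ : face.obj e.1} (u : PreTube D e φ) (f : e ⟶ e') :
    PreTube D e' (face.map f.val φ) :=
  fun _ g h r => u _ (f ≫ g) (PartialPath.holds_comp h) r

open Classical in
/-- Restriction of pre-terms along `f`. A formal composition is sent to `u_{f,1}` where its tube
becomes total, and to a formal composition elsewhere. -/
noncomputable def restrict {e : U.Elements} (t : PreTerm D e) {e' : U.Elements} (f : e ⟶ e') :
    PreTerm D e' :=
  iter (D := D) (M := fun e => ∀ e' : U.Elements, (e ⟶ e') → PreTerm D e')
    (fun _ a _ f => inl (D.A.map f a))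
    (fun _ b _ f => inr (D.B.map f b))
    (fun _ c r _ _ _ f => glue (D.C.map f c) (interval.map f.val r))
    (fun _ φ _ u _ _ u₀' e' f =>
      if h : Holds (face.map f.val φ) then u e' f h (interval.one e'.1)
      else hcomp (face.map f.val φ) h (reindexTube u f) (u₀' e' f))
    t e' f

theorem inl_restrict {e e' : U.Elements} (a : D.A.obj e) (f : e ⟶ e') :
    (inl a).restrict f = inl (D.A.map f a) := rfl

theorem inr_restrict {e e' : U.Elements} (b : D.B.obj e) (f : e ⟶ e') :
    (inr b).restrict f = inr (D.B.map f b) := rfl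

theorem glue_restrict {e e' : U.Elements} (c : D.C.obj e) (r : interval.obj e.1) (f : e ⟶ e') :
    (glue c r).restrict f = glue (D.C.map f c) (interval.map f.val r) := by
  by_cases h₀ : r = interval.zero e.1
  · subst h₀
    rw [glue_zero, inl_restrict, ← NatTrans.naturality_apply]
    exact (glue_zero _).symm
  by_cases h₁ : r = interval.one e.1
  · subst h₁
    rw [glue_one, inr_restrict, ← NatTrans.naturality_apply]
    exact (glue_one _).symm
  rw [glue_eq_push c h₀ h₁]
  rfl

theorem push_restrict {e e' : U.Elements} (c : D.C.obj e) (r : interval.obj e.1)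
    (h₀ : r ≠ interval.zero e.1) (h₁ : r ≠ interval.one e.1) (f : e ⟶ e') :
    (push c r h₀ h₁).restrict f = glue (D.C.map f c) (interval.map f.val r) := rfl

section Hcomp

variable {e : U.Elements} {φ : face.obj e.1} (hφ : ¬ Holds φ) (u : PreTube D e φ)
  (u₀ : PreTerm D e) {e' : U.Elements} (f : e ⟶ e')

theorem hcomp_restrict_of_holds (h : Holds (face.map f.val φ)) :
    (hcomp φ hφ u u₀).restrict f = u e' f h (interval.one e'.1) := by
  rw [restrict, iter_hcomp]
  exact dif_pos h

theorem hcomp_restrict_of_not_holds (h : ¬ Holds (face.map f.val φ)) :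
    (hcomp φ hφ u u₀).restrict f =
      hcomp (face.map f.val φ) h (reindexTube u f) (u₀.restrict f) := by
  rw [restrict, iter_hcomp]
  exact dif_neg h

end Hcomp

theorem restrict_id {e : U.Elements} (t : PreTerm D e) : t.restrict (𝟙 e) = t := by
  induction t using recOn' with
  | inl' e a => rw [inl_restrict, Functor.map_id_apply]
  | inr' e b => rw [inr_restrict, Functor.map_id_apply]
  | push' e c r h₀ h₁ =>
    rw [push_restrict, Functor.map_id_apply, ← glue_eq_push c h₀ h₁]
    exact congrArg _ (Functor.map_id_apply interval _ r)
  | hcomp' e φ hφ u u₀ _ ih₀ =>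
    have hid : face.map (𝟙 e : e ⟶ e).val φ = φ := Functor.map_id_apply face _ φ
    rw [hcomp_restrict_of_not_holds _ _ _ _ (by rwa [hid])]
    refine hcomp_congr _ _ hid (fun e' f hf hf' r => ?_) ih₀
    exact tube_congr u (Category.id_comp f) _ _ rfl

/-- The naturality condition `u_{f,r} g = u_{fg,rg}`. -/
def TubeNatural {e : U.Elements} {φ : face.obj e.1} (u : PreTube D e φ) : Prop :=
  ∀ {e' e'' : U.Elements} (f : e ⟶ e') (g : e' ⟶ e'') (h : Holds (face.map f.val φ))
    (h' : Holds (face.map (f ≫ g).val φ)) (r : interval.obj e'.1),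
    (u e' f h r).restrict g = u e'' (f ≫ g) h' (interval.map g.val r)

/-- The condition `φ ⇒ u 0 = u₀`. -/
def TubeStartsAt {e : U.Elements} {φ : face.obj e.1} (u : PreTube D e φ) (u₀ : PreTerm D e) :
    Prop :=
  ∀ {e' : U.Elements} (f : e ⟶ e') (h : Holds (face.map f.val φ)),
    u e' f h (interval.zero e'.1) = u₀.restrict f

/-- A pre-term is coherent if, hereditarily, the tubes of its formal compositions are natural and
start at the given bases. Restriction need not be functorial on other pre-terms. -/
def Coherent {e : U.Elements} (t : PreTerm D e) : Prop :=
  iter (D := D) (M := fun _ => Prop) (fun _ _ => True) (fun _ _ => True) (fun _ _ _ _ _ => True)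
    (fun _ _ _ u u₀ ih ih₀ =>
      (∀ e' f h r, ih e' f h r) ∧ ih₀ ∧ TubeNatural u ∧ TubeStartsAt u u₀) t

theorem coherent_inl {e : U.Elements} (a : D.A.obj e) : (inl a).Coherent := trivial

theorem coherent_inr {e : U.Elements} (b : D.B.obj e) : (inr b).Coherent := trivial

theorem coherent_glue {e : U.Elements} (c : D.C.obj e) (r : interval.obj e.1) :
    (glue c r).Coherent := by
  unfold glue
  split_ifs <;> trivial

theorem coherent_hcomp {e : U.Elements} {φ : face.obj e.1} {hφ : ¬ Holds φ} {u : PreTube D e φ}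
    {u₀ : PreTerm D e} : (hcomp φ hφ u u₀).Coherent ↔
      (∀ e' f h r, (u e' f h r).Coherent) ∧ u₀.Coherent ∧ TubeNatural u ∧ TubeStartsAt u u₀ := by
  rw [Coherent, iter_hcomp]
  rfl

/-- Induction on coherent pre-terms, with `glue` in place of `push`. -/
@[elab_as_elim]
theorem Coherent.induction {P : ∀ {e : U.Elements} (t : PreTerm D e), t.Coherent → Prop}
    (inl' : ∀ {e : U.Elements} (a : D.A.obj e), P (inl a) (coherent_inl a))
    (inr' : ∀ {e : U.Elements} (b : D.B.obj e), P (inr b) (coherent_inr b))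
    (glue' : ∀ {e : U.Elements} (c : D.C.obj e) (r : interval.obj e.1),
      P (glue c r) (coherent_glue c r))
    (hcomp' : ∀ {e : U.Elements} (φ : face.obj e.1) (hφ : ¬ Holds φ) (u : PreTube D e φ)
      (u₀ : PreTerm D e) (h : ∀ e' f h r, (u e' f h r).Coherent) (h₀ : u₀.Coherent)
      (hn : TubeNatural u) (hs : TubeStartsAt u u₀),
      (∀ e' f hf r, P (u e' f hf r) (h e' f hf r)) → P u₀ h₀ →
        P (hcomp φ hφ u u₀) (coherent_hcomp.2 ⟨h, h₀, hn, hs⟩))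
    {e : U.Elements} {t : PreTerm D e} (ht : t.Coherent) : P t ht := by
  induction t using recOn' with
  | inl' e a => exact inl' a
  | inr' e b => exact inr' b
  | push' e c r h₀ h₁ =>
    have := glue' c r
    simp only [glue_eq_push c h₀ h₁] at this
    exact this
  | hcomp' e φ hφ u u₀ ih ih₀ =>
    obtain ⟨h, h₀, hn, hs⟩ := coherent_hcomp.1 ht
    exact hcomp' φ hφ u u₀ h h₀ hn hs (fun e' f hf r => ih e' f hf r (h e' f hf r)) (ih₀ h₀)

theorem Coherent.restrict_restrict {e : U.Elements} {t : PreTerm D e} (ht : t.Coherent) :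
    ∀ {e' e'' : U.Elements} (f : e ⟶ e') (g : e' ⟶ e''),
      (t.restrict f).restrict g = t.restrict (f ≫ g) := by
  induction ht using Coherent.induction with
  | inl' a => intros; simp only [inl_restrict, Functor.map_comp_apply]
  | inr' b => intros; simp only [inr_restrict, Functor.map_comp_apply]
  | glue' c r =>
    intros
    rw [glue_restrict, glue_restrict, glue_restrict, interval_map_comp, Functor.map_comp_apply]
  | hcomp' φ hφ u u₀ _ _ hn _ _ ih₀ =>
    intro e' e'' f g
    by_cases h : Holds (face.map f.val φ)
    · have h' : Holds (face.map (f ≫ g).val φ) := by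
        rw [← face_map_comp]
        exact h.map g.val
      rw [hcomp_restrict_of_holds _ _ _ _ h, hcomp_restrict_of_holds _ _ _ _ h', hn f g h h']
      rfl
    rw [hcomp_restrict_of_not_holds _ _ _ _ h]
    by_cases h' : Holds (face.map (f ≫ g).val φ)
    · rw [hcomp_restrict_of_holds _ _ _ _ h',
        hcomp_restrict_of_holds _ _ _ _ (by rwa [face_map_comp])]
      rfl
    rw [hcomp_restrict_of_not_holds _ _ _ _ h',
        hcomp_restrict_of_not_holds _ _ _ _ (by rwa [face_map_comp])]
    refine hcomp_congr _ _ (face_map_comp f g φ) (fun _ k _ _ r => ?_) (ih₀ f g)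
    exact tube_congr u (Category.assoc f g k).symm _ _ rfl

theorem TubeNatural.reindex {e e' : U.Elements} {φ : face.obj e.1} {u : PreTube D e φ}
    (hu : TubeNatural u) (f : e ⟶ e') : TubeNatural (reindexTube u f) := by
  intro _ _ g k h h' r
  have hk : Holds (face.map ((f ≫ g) ≫ k).val φ) := by
    rw [Category.assoc]
    exact PartialPath.holds_comp h'
  refine (hu (f ≫ g) k (PartialPath.holds_comp h) hk r).trans ?_
  exact tube_congr u (Category.assoc f g k) _ _ rfl

theorem Coherent.restrict {e : U.Elements} {t : PreTerm D e} (ht : t.Coherent) :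
    ∀ {e' : U.Elements} (f : e ⟶ e'), (t.restrict f).Coherent := by
  induction ht using Coherent.induction with
  | inl' a => exact fun _ => coherent_inl _
  | inr' b => exact fun _ => coherent_inr _
  | glue' c r =>
    intro e' f
    rw [glue_restrict]
    exact coherent_glue _ _
  | hcomp' φ hφ u u₀ h h₀ hn hs ih ih₀ =>
    intro e' f
    by_cases hf : Holds (face.map f.val φ)
    · rw [hcomp_restrict_of_holds _ _ _ _ hf]
      exact h _ _ _ _
    rw [hcomp_restrict_of_not_holds _ _ _ _ hf, coherent_hcomp]
    refine ⟨fun _ _ _ _ => h _ _ _ _, ih₀ f, hn.reindex f, fun g hg => ?_⟩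
    exact (hs (f ≫ g) _).trans (h₀.restrict_restrict f g).symm

-- From here on these are used through the lemmas above; unfolding them makes unification slow.
attribute [irreducible] restrict glue Coherent

end PreTerm

end Coherence

/-! ### Codes -/

/-- A natural transformation between cubical sets whose values may lie in different universes. The
case of interest is a map `Γ → U` into the universe of spans, which classifies a span over `Γ`. -/
@[ext]
structure Code (Γ : CSet.{w}) (U : CSet.{u}) where
  /-- the components -/
  app : ∀ {I : Cubeᵒᵖ}, Γ.obj I → U.obj I
  natural : ∀ {I J : Cubeᵒᵖ} (f : I ⟶ J) (ρ : Γ.obj I), U.map f (app ρ) = app (Γ.map f ρ)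

namespace Code

variable {Γ : CSet.{w}} {U : CSet.{u}} (c : Code Γ U)

/-- The functor on categories of elements. -/
def elements : Γ.Elements ⥤ U.Elements where
  obj e := ⟨e.1, c.app e.2⟩
  map {e e'} f := ⟨f.val, (c.natural f.val e.2).trans (congrArg c.app f.property)⟩

/-- Composition of a code with a map of cubical sets. -/
def precomp {Δ : CSet.{w}} (σ : Δ ⟶ Γ) : Code Δ U where
  app ρ := c.app (σ.app _ ρ)
  natural f ρ := by rw [c.natural, NatTrans.naturality_apply]

/-- Substitution of types along a code. -/
abbrev reindexTy (A : Ty.{u, v} U) : Ty.{w, v} Γ := c.elements ⋙ A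

/-- Substitution of spans along a code. -/
def reindexSpan (D : TySpan.{u, v} U) : TySpan.{w, v} Γ where
  C := c.elements ⋙ D.C
  A := c.elements ⋙ D.A
  B := c.elements ⋙ D.B
  u := Functor.whiskerLeft c.elements D.u
  v := Functor.whiskerLeft c.elements D.v

/-- The identification of `c (ρ f)` with `(c ρ) f`. -/
def resIso {e : Γ.Elements} {e' : U.Elements} (f : c.elements.obj e ⟶ e') :
    c.elements.obj (res e f.val) ⟶ e' :=
  ⟨𝟙 _, by
    have h : U.map f.val (c.app e.2) = e'.2 := f.property
    exact (Functor.map_id_apply U _ _).trans ((c.natural f.val e.2).symm.trans h)⟩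

theorem map_toRes_resIso {e : Γ.Elements} {e' : U.Elements} (f : c.elements.obj e ⟶ e') :
    c.elements.map (toRes e f.val) ≫ c.resIso f = f :=
  CategoryOfElements.ext _ _ _ (Category.comp_id _)

end Code

/-! ### The free algebra -/

section FreeAlgebra

open PreTerm

variable {Γ : CSet.{w}} {U : CSet.{u}} (c : Code Γ U) (D : TySpan.{u, v} U)

/-- The type over `Γ` whose elements at `ρ` are the coherent pre-terms over `c ρ`. -/
noncomputable def freeTy : Ty.{w, v} Γ where
  obj e := {t : PreTerm D (c.elements.obj e) // t.Coherent}
  map f := ↾fun t => ⟨t.1.restrict (c.elements.map f), t.2.restrict _⟩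
  map_id e := by
    ext t
    exact (congrArg t.1.restrict (c.elements.map_id e)).trans (restrict_id t.1)
  map_comp f g := by
    ext t
    exact (congrArg t.1.restrict (c.elements.map_comp f g)).trans
      (t.2.restrict_restrict _ _).symm

variable {c D}

/-- Every morphism out of `c ρ` is, up to the identification `resIso`, the image of a restriction
of `ρ`. -/
theorem PreTerm.TubeNatural.eq_restrict {e : Γ.Elements} {φ : face.obj e.1}
    {u : PreTube D (c.elements.obj e) φ} (hu : TubeNatural u) {e' : U.Elements}
    (f : c.elements.obj e ⟶ e') (h : Holds (face.map f.val φ)) (r : interval.obj e'.1) :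
    u e' f h r = (u _ (c.elements.map (toRes e f.val)) h r).restrict (c.resIso f) := by
  have hf := c.map_toRes_resIso f
  refine Eq.trans ?_ (hu _ (c.resIso f) h (by rw [hf]; exact h) r).symm
  exact tube_congr u hf.symm _ _ (Functor.map_id_apply interval _ _).symm

theorem PreTerm.TubeNatural.ext_of_code {e : Γ.Elements} {φ : face.obj e.1}
    {u u' : PreTube D (c.elements.obj e) φ} (hu : TubeNatural u) (hu' : TubeNatural u')
    (H : ∀ {e' : Γ.Elements} (f : e ⟶ e') (h : Holds (face.map f.val φ)) (r : interval.obj e'.1),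
      u _ (c.elements.map f) h r = u' _ (c.elements.map f) h r) : u = u' := by
  funext e' f h r
  have := H (toRes e f.val) h r
  refine (hu.eq_restrict f h r).trans (Eq.trans ?_ (hu'.eq_restrict f h r).symm)
  exact congrArg (fun t : PreTerm D (c.elements.obj (res e f.val)) => t.restrict (c.resIso f)) this

/-- The family of pre-terms over `c ρ` that underlies a partial path over `ρ`. -/
noncomputable def pushTube {e : Γ.Elements} {φ : face.obj e.1}
    (u : PartialPath (freeTy c D) e φ) :
    PreTube D (c.elements.obj e) φ :=
  fun _ f h r => (u.val (toRes e f.val) h r).1.restrict (c.resIso f)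

section PushTube

variable {e : Γ.Elements} {φ : face.obj e.1} (u : PartialPath (freeTy c D) e φ)

theorem pushTube_map {e' : Γ.Elements} (f : e ⟶ e')
    (h : Holds (face.map f.val φ)) (r : interval.obj e'.1) :
    pushTube u _ (c.elements.map f) h r = (u.val f h r).1 := by
  let k : res e f.val ⟶ e' := ⟨𝟙 _, (Functor.map_id_apply Γ _ _).trans f.property⟩
  have hk : toRes e f.val ≫ k = f := CategoryOfElements.ext _ _ _ (Category.comp_id _)
  have := congrArg Subtype.val (u.natural (toRes e f.val) k h (by rw [hk]; exact h) r)
  exact this.trans (congrArg Subtype.val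
    (u.val_congr hk _ _ (Functor.map_id_apply interval _ _)))

theorem coherent_pushTube {e' : U.Elements} (f : c.elements.obj e ⟶ e')
    (h : Holds (face.map f.val φ)) (r : interval.obj e'.1) : (pushTube u e' f h r).Coherent :=
  (u.val (toRes e f.val) h r).2.restrict _

theorem tubeNatural_pushTube : TubeNatural (pushTube u) := by
  intro e' e'' f g h h' r
  let k : res e f.val ⟶ res e (f ≫ g).val := ⟨g.val, (Functor.map_comp_apply Γ _ _ _).symm⟩
  have hk : c.resIso f ≫ g = c.elements.map k ≫ c.resIso (f ≫ g) :=
    CategoryOfElements.ext _ _ _ ((Category.id_comp _).trans (Category.comp_id _).symm)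
  have := congrArg Subtype.val (u.natural (toRes e f.val) k h h' r)
  refine Eq.trans ?_ (congrArg (fun t => t.restrict (c.resIso (f ≫ g))) this)
  refine ((u.val (toRes e f.val) h r).2.restrict_restrict _ _).trans ?_
  rw [hk]
  exact ((u.val (toRes e f.val) h r).2.restrict_restrict _ _).symm

theorem tubeStartsAt_pushTube {u₀ : (freeTy c D).obj e} (h₀ : u.StartsAt u₀) :
    TubeStartsAt (pushTube u) u₀.1 := by
  intro e' f h
  refine (congrArg (fun t => t.1.restrict (c.resIso f)) (h₀ (toRes e f.val) h)).trans ?_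
  refine (u₀.2.restrict_restrict _ _).trans ?_
  rw [c.map_toRes_resIso]

theorem pushTube_restrict {e' : Γ.Elements} (f : e ⟶ e') :
    pushTube (u.restrict f) = reindexTube (pushTube u) (c.elements.map f) := by
  refine TubeNatural.ext_of_code (u := pushTube (u.restrict f))
    (u' := reindexTube (pushTube u) (c.elements.map f)) (tubeNatural_pushTube (u.restrict f))
    (TubeNatural.reindex (e := c.elements.obj e) (tubeNatural_pushTube u) (c.elements.map f)) ?_
  intro e'' g h r
  rw [pushTube_map]
  refine (pushTube_map u (f ≫ g) (PartialPath.holds_comp h) r).symm.trans ?_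
  exact tube_congr _ (c.elements.map_comp f g) _ _ rfl

end PushTube

open Classical in
/-- The composition operation: a formal composition, unless the tube is total. -/
noncomputable def freeComp {e : Γ.Elements} (φ : face.obj e.1)
    (u : PartialPath (freeTy c D) e φ) (u₀ : (freeTy c D).obj e) (h₀ : u.StartsAt u₀) :
    (freeTy c D).obj e :=
  if h : Holds φ then u.val (𝟙 e) (h.map _) (interval.one e.1)
  else ⟨PreTerm.hcomp (e := c.elements.obj e) φ h (pushTube u) u₀.1,
    coherent_hcomp.2 ⟨fun _ => coherent_pushTube u, u₀.2, tubeNatural_pushTube u,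
      tubeStartsAt_pushTube u h₀⟩⟩

theorem freeComp_of_holds {e : Γ.Elements} {φ : face.obj e.1}
    (u : PartialPath (freeTy c D) e φ) (u₀ : (freeTy c D).obj e) (h₀ : u.StartsAt u₀)
    (h : Holds φ) : freeComp φ u u₀ h₀ = u.val (𝟙 e) (h.map _) (interval.one e.1) :=
  dif_pos h

theorem freeComp_of_not_holds {e : Γ.Elements} {φ : face.obj e.1}
    (u : PartialPath (freeTy c D) e φ) (u₀ : (freeTy c D).obj e) (h₀ : u.StartsAt u₀)
    (h : ¬ Holds φ) : (freeComp φ u u₀ h₀).1 =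
      PreTerm.hcomp (e := c.elements.obj e) φ h (pushTube u) u₀.1 :=
  congrArg Subtype.val (dif_neg h)

theorem freeComp_extends_one {e : Γ.Elements} (φ : face.obj e.1)
    (u : PartialPath (freeTy c D) e φ) (u₀ : (freeTy c D).obj e) (h₀ : u.StartsAt u₀)
    {e' : Γ.Elements} (f : e ⟶ e') (h : Holds (face.map f.val φ)) :
    u.val f h (interval.one e'.1) = (freeTy c D).map f (freeComp φ u u₀ h₀) := by
  by_cases hφ : Holds φ
  · rw [freeComp_of_holds u u₀ h₀ hφ, u.natural (𝟙 e) f _ (hφ.map _)]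
    exact u.val_congr (Category.id_comp f).symm _ _ rfl
  · refine Subtype.ext ?_
    refine Eq.trans ?_ (congrArg (fun t : PreTerm D (c.elements.obj e) => t.restrict (c.elements.map f))
      (freeComp_of_not_holds u u₀ h₀ hφ)).symm
    exact (pushTube_map u f h _).symm.trans
      (hcomp_restrict_of_holds (e := c.elements.obj e) hφ _ _ (c.elements.map f) h).symm

theorem freeComp_natural {e : Γ.Elements} (φ : face.obj e.1)
    (u : PartialPath (freeTy c D) e φ) (u₀ : (freeTy c D).obj e) (h₀ : u.StartsAt u₀)
    {e' : Γ.Elements} (f : e ⟶ e') :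
    (freeTy c D).map f (freeComp φ u u₀ h₀) =
      freeComp (face.map f.val φ) (u.restrict f) ((freeTy c D).map f u₀) (h₀.restrict f) := by
  by_cases h : Holds (face.map f.val φ)
  · rw [← freeComp_extends_one φ u u₀ h₀ f h, freeComp_of_holds _ _ _ h]
    exact u.val_congr (Category.comp_id f).symm _ _ rfl
  · have hφ : ¬ Holds φ := fun hφ => h (hφ.map _)
    refine Subtype.ext ?_
    rw [freeComp_of_not_holds _ _ _ h]
    refine (congrArg (fun t : PreTerm D (c.elements.obj e) => t.restrict (c.elements.map f))
      (freeComp_of_not_holds u u₀ h₀ hφ)).trans ?_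
    refine (hcomp_restrict_of_not_holds (e := c.elements.obj e) hφ _ _ (c.elements.map f) h).trans ?_
    rw [pushTube_restrict]
    rfl

variable (c D)

/-- The algebra of coherent pre-terms over the span classified by `c`. -/
noncomputable def freeAlgebra : PushoutAlgebra (c.reindexSpan D) where
  carrier := freeTy c D
  hcomp :=
    { comp := freeComp
      extends_one := freeComp_extends_one
      natural := freeComp_natural }
  inl :=
    { app := fun e => ↾fun a => ⟨PreTerm.inl (e := c.elements.obj e) a, coherent_inl _⟩
      naturality := fun e e' f => by
        ext a
        exact Subtype.ext (inl_restrict (e := c.elements.obj e) a (c.elements.map f)).symm }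
  inr :=
    { app := fun e => ↾fun b => ⟨PreTerm.inr (e := c.elements.obj e) b, coherent_inr _⟩
      naturality := fun e e' f => by
        ext b
        exact Subtype.ext (inr_restrict (e := c.elements.obj e) b (c.elements.map f)).symm }
  push :=
    { val := fun x r => ⟨glue (e := c.elements.obj _) x r, coherent_glue _ _⟩
      natural := fun f x r => Subtype.ext (glue_restrict (e := c.elements.obj _) x r (c.elements.map f)) }
  push_zero {e} x := Subtype.ext (glue_zero (e := c.elements.obj e) x)
  push_one {e} x := Subtype.ext (glue_one (e := c.elements.obj e) x)

end FreeAlgebra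

/-! ### Initiality -/

section Initiality

open PreTerm

variable {Γ : CSet.{w}} {U : CSet.{u}} {c : Code Γ U} {D : TySpan.{u, v} U}

theorem HComp.comp_congr {A : Ty.{w, v} Γ} (H : HComp A) {e : Γ.Elements} {φ : face.obj e.1}
    {u u' : PartialPath A e φ} {u₀ u₀' : A.obj e} (hu : u = u') (hu₀ : u₀ = u₀')
    (h : u.StartsAt u₀) (h' : u'.StartsAt u₀') : H.comp φ u u₀ h = H.comp φ u' u₀' h' := by
  subst hu hu₀; rfl

/-- Induction on the coherent pre-terms over objects of the form `c ρ`. -/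
theorem PreTerm.Coherent.induction_along
    {P : ∀ {ρ : Γ.Elements} (t : PreTerm D (c.elements.obj ρ)), t.Coherent → Prop}
    (inl' : ∀ {ρ : Γ.Elements} (a : D.A.obj (c.elements.obj ρ)), P (inl a) (coherent_inl a))
    (inr' : ∀ {ρ : Γ.Elements} (b : D.B.obj (c.elements.obj ρ)), P (inr b) (coherent_inr b))
    (glue' : ∀ {ρ : Γ.Elements} (x : D.C.obj (c.elements.obj ρ)) (r : interval.obj ρ.1),
      P (glue (e := c.elements.obj ρ) x r) (coherent_glue _ _))
    (hcomp' : ∀ {ρ : Γ.Elements} (φ : face.obj ρ.1) (hφ : ¬ Holds φ)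
      (u : PreTube D (c.elements.obj ρ) φ) (u₀ : PreTerm D (c.elements.obj ρ))
      (h : ∀ e' f h r, (u e' f h r).Coherent) (h₀ : u₀.Coherent)
      (hn : TubeNatural u) (hs : TubeStartsAt u u₀),
      (∀ {ρ' : Γ.Elements} (f : ρ ⟶ ρ') (hf : Holds (face.map f.val φ)) (r : interval.obj ρ'.1),
        P (u _ (c.elements.map f) hf r) (h _ (c.elements.map f) hf r)) → P u₀ h₀ →
        P (hcomp (e := c.elements.obj ρ) φ hφ u u₀) (coherent_hcomp.2 ⟨h, h₀, hn, hs⟩))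
    {ρ : Γ.Elements} {t : PreTerm D (c.elements.obj ρ)} (ht : t.Coherent) : P t ht := by
  have key : ∀ {e : U.Elements} {t : PreTerm D e} (ht : t.Coherent) (ρ : Γ.Elements)
      (h : c.elements.obj ρ = e), P (ρ := ρ) (h ▸ t) (by subst h; exact ht) := by
    intro e t ht
    induction ht using Coherent.induction with
    | inl' a => rintro ρ rfl; exact inl' a
    | inr' a => rintro ρ rfl; exact inr' a
    | glue' x r => rintro ρ rfl; exact glue' x r
    | hcomp' φ hφ u u₀ h h₀ hn hs ih ih₀ =>
      rintro ρ rfl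
      exact hcomp' (ρ := ρ) φ hφ u u₀ h h₀ hn hs 
        (fun {ρ'} f hf r => ih (c.elements.obj ρ') (c.elements.map f) hf r ρ' rfl) (ih₀ ρ rfl)
  exact key ht ρ rfl

variable (T : PushoutAlgebra (c.reindexSpan D))

open Classical in
/-- The value of a pre-term over `e` in an algebra, at every `ρ` with `c ρ = e`. A formal composition
is evaluated by the composition of `T` if the values of its tube form a partial path starting at
the value of its base. This holds for coherent pre-terms, as shown along with naturality in
`elim_restrict`; otherwise the base supplies an arbitrary value. -/
noncomputable def elimAux {e : U.Elements} (t : PreTerm D e) :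
    ∀ ρ : Γ.Elements, c.elements.obj ρ = e → T.carrier.obj ρ :=
  iter (D := D) (M := fun e => ∀ ρ : Γ.Elements, c.elements.obj ρ = e → T.carrier.obj ρ)
    (fun _ a ρ h => T.inl.app ρ (h ▸ a : D.A.obj (c.elements.obj ρ)))
    (fun _ b ρ h => T.inr.app ρ (h ▸ b : D.B.obj (c.elements.obj ρ)))
    (fun _ x r _ _ ρ h => T.push.val (h ▸ x : D.C.obj (c.elements.obj ρ))
      (h ▸ r : interval.obj (c.elements.obj ρ).1))
    (fun e φ _ _ _ k k₀ ρ h => by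
      subst h
      exact if H : ∃ p : PartialPath T.carrier ρ φ, p.StartsAt (k₀ ρ rfl) ∧
            ∀ {ρ' : Γ.Elements} (f : ρ ⟶ ρ') (h : Holds (face.map f.val φ))
              (r : interval.obj ρ'.1), p.val f h r = k _ (c.elements.map f) h r ρ' rfl
        then T.hcomp.comp φ H.choose (k₀ ρ rfl) H.choose_spec.1
        else k₀ ρ rfl) t

/-- The value in `T` of a pre-term over `c ρ`. -/
noncomputable def elim {ρ : Γ.Elements} (t : PreTerm D (c.elements.obj ρ)) : T.carrier.obj ρ :=
  elimAux T t ρ rfl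

theorem elim_glue {ρ : Γ.Elements} (x : D.C.obj (c.elements.obj ρ)) (r : interval.obj ρ.1) :
    elim T (glue (e := c.elements.obj ρ) x r) = T.push.val x r := by
  by_cases h₀ : r = interval.zero ρ.1
  · subst h₀
    exact (congrArg (elim T) (glue_zero (e := c.elements.obj ρ) x)).trans (T.push_zero x).symm
  by_cases h₁ : r = interval.one ρ.1
  · subst h₁
    exact (congrArg (elim T) (glue_one (e := c.elements.obj ρ) x)).trans (T.push_one x).symm
  rw [glue_eq_push (e := c.elements.obj ρ) x h₀ h₁]
  rfl

theorem elim_hcomp {ρ : Γ.Elements} {φ : face.obj ρ.1} (hφ : ¬ Holds φ)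
    (u : PreTube D (c.elements.obj ρ) φ) (u₀ : PreTerm D (c.elements.obj ρ))
    (p : PartialPath T.carrier ρ φ)
    (hp : ∀ {ρ' : Γ.Elements} (f : ρ ⟶ ρ') (h : Holds (face.map f.val φ))
      (r : interval.obj ρ'.1), p.val f h r = elim T (u _ (c.elements.map f) h r))
    (h₀ : p.StartsAt (elim T u₀)) :
    elim T (hcomp (e := c.elements.obj ρ) φ hφ u u₀) = T.hcomp.comp φ p (elim T u₀) h₀ := by
  have H : ∃ p : PartialPath T.carrier ρ φ, p.StartsAt (elim T u₀) ∧
      ∀ {ρ' : Γ.Elements} (f : ρ ⟶ ρ') (h : Holds (face.map f.val φ)) (r : interval.obj ρ'.1),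
        p.val f h r = elim T (u _ (c.elements.map f) h r) := ⟨p, h₀, hp⟩
  have hH : H.choose = p := by
    ext ρ' f hf r
    rw [H.choose_spec.2, hp]
  refine (congrFun (congrFun
    (iter_hcomp (e := c.elements.obj ρ) _ _ _ _ φ hφ u u₀) ρ) rfl).trans ?_
  refine (dif_pos H).trans ?_
  exact T.hcomp.comp_congr hH rfl H.choose_spec.1 h₀

/-- Evaluation is natural. For formal compositions this contains the fact that the values of the
tube form a partial path starting at the value of the base. -/
theorem elim_restrict {ρ : Γ.Elements} {t : PreTerm D (c.elements.obj ρ)} (ht : t.Coherent) :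
    ∀ {ρ' : Γ.Elements} (f : ρ ⟶ ρ'),
      elim T (t.restrict (c.elements.map f)) = T.carrier.map f (elim T t) := by
  induction ht using Coherent.induction_along with
  | inl' a =>
    intro ρ' f
    exact (congrArg (elim T) (inl_restrict a (c.elements.map f))).trans
      (NatTrans.naturality_apply T.inl f a)
  | inr' b =>
    intro ρ' f
    exact (congrArg (elim T) (inr_restrict b (c.elements.map f))).trans
      (NatTrans.naturality_apply T.inr f b)
  | @glue' ρ x r =>
    intro ρ' f
    refine (congrArg (elim T) (glue_restrict (e := c.elements.obj ρ) x r
      (c.elements.map f))).trans ?_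
    rw [elim_glue T x r, T.push.natural f x r]
    exact elim_glue T (D.C.map (c.elements.map f) x) (interval.map f.val r)
  | @hcomp' ρ φ hφ u u₀ h h₀ hn hs ih ih₀ =>
    intro ρ' f
    let p : PartialPath T.carrier ρ φ :=
      { val := fun f h r => elim T (u _ (c.elements.map f) h r)
        natural := fun {e' e''} f g h h' r => by
          refine (ih f h r g).symm.trans (congrArg (elim T) ?_)
          refine (hn (c.elements.map f) (c.elements.map g) h h' r).trans ?_
          exact tube_congr u (c.elements.map_comp f g).symm _ _ rfl }
    have hp : p.StartsAt (elim T u₀) := fun {e'} f hf =>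
      (congrArg (elim T) (hs (c.elements.map f) hf)).trans (ih₀ f)
    rw [elim_hcomp T hφ u u₀ p (fun _ _ _ => rfl) hp]
    by_cases hf : Holds (face.map f.val φ)
    · rw [← T.hcomp.extends_one φ p _ hp f hf]
      exact congrArg (elim T)
        (hcomp_restrict_of_holds (e := c.elements.obj ρ) hφ u u₀ (c.elements.map f) hf)
    · rw [T.hcomp.natural φ p _ hp f]
      refine (congrArg (elim T) (hcomp_restrict_of_not_holds (e := c.elements.obj ρ) hφ u u₀
        (c.elements.map f) hf)).trans ?_
      have hp' : (p.restrict f).StartsAt (elim T (u₀.restrict (c.elements.map f))) := by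
        rw [ih₀ f]
        exact hp.restrict f
      refine Eq.trans ?_ (T.hcomp.comp_congr rfl (ih₀ f) hp' _)
      refine elim_hcomp T hf _ _ (p.restrict f) (fun g hg r => congrArg (elim T) ?_) hp'
      exact tube_congr u (c.elements.map_comp f g) _ _ rfl

variable (c D) in
/-- Every coherent formal composition is a composite in the free algebra. -/
theorem exists_freeComp_eq {ρ : Γ.Elements} (φ : face.obj ρ.1) (hφ : ¬ Holds φ)
    (u : PreTube D (c.elements.obj ρ) φ) (u₀ : PreTerm D (c.elements.obj ρ))
    (h : ∀ e' f h r, (u e' f h r).Coherent) (h₀ : u₀.Coherent) (hn : TubeNatural u)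
    (hs : TubeStartsAt u u₀) :
    ∃ (p : PartialPath (freeTy c D) ρ φ) (hp : p.StartsAt ⟨u₀, h₀⟩),
      (∀ {ρ' : Γ.Elements} (f : ρ ⟶ ρ') (hf : Holds (face.map f.val φ)) (r : interval.obj ρ'.1),
        p.val f hf r = ⟨u _ (c.elements.map f) hf r, h _ (c.elements.map f) hf r⟩) ∧
      freeComp φ p ⟨u₀, h₀⟩ hp =
        ⟨hcomp (e := c.elements.obj ρ) φ hφ u u₀, coherent_hcomp.2 ⟨h, h₀, hn, hs⟩⟩ := by
  let p : PartialPath (freeTy c D) ρ φ :=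
    { val := fun {ρ'} f hf r => ⟨u _ (c.elements.map f) hf r, h _ (c.elements.map f) hf r⟩
      natural := fun {e' e''} f g h h' r => by
        refine Subtype.ext ((hn (c.elements.map f) (c.elements.map g) h h' r).trans ?_)
        exact tube_congr u (c.elements.map_comp f g).symm _ _ rfl }
  have hp : p.StartsAt ⟨u₀, h₀⟩ := fun {e'} f hf => Subtype.ext (hs (c.elements.map f) hf)
  refine ⟨p, hp, fun _ _ _ => rfl, Subtype.ext ?_⟩
  have hpu : pushTube p = u :=
    TubeNatural.ext_of_code (tubeNatural_pushTube p) hn fun f hf r => pushTube_map p f hf r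
  rw [freeComp_of_not_holds p _ hp hφ, hpu]

/-- Evaluation as a map of types. -/
noncomputable def elimMap : freeTy c D ⟶ T.carrier where
  app _ := ↾fun t => elim T t.1
  naturality ρ ρ' f := by
    ext t
    exact elim_restrict T t.2 f

/-- Evaluation as a map of algebras. -/
noncomputable def freeDesc : freeAlgebra c D ⟶ T where
  map := elimMap T
  preserves {ρ} φ u u₀ h₀ := by
    by_cases hφ : Holds φ
    · refine (congrArg (fun t => elim T t.1) (freeComp_of_holds u u₀ h₀ hφ)).trans ?_
      refine (T.hcomp.extends_one φ (u.map (elimMap T)) _ (h₀.map (elimMap T)) (𝟙 ρ)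
        (hφ.map _)).trans ?_
      exact Functor.map_id_apply _ _ _
    · refine (congrArg (elim T) (freeComp_of_not_holds u u₀ h₀ hφ)).trans ?_
      refine elim_hcomp T hφ _ _ _ (fun f hf r => ?_) _
      exact (congrArg (elim T) (pushTube_map u f hf r)).symm
  map_inl _ := rfl
  map_inr _ := rfl
  map_push x r := elim_glue T x r

theorem hom_app_eq_elim (α : freeAlgebra c D ⟶ T) {ρ : Γ.Elements}
    {t : PreTerm D (c.elements.obj ρ)} (ht : t.Coherent) :
    α.map.app ρ ⟨t, ht⟩ = elim T t := by
  induction ht using Coherent.induction_along with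
  | inl' a => exact α.map_inl a
  | inr' b => exact α.map_inr b
  | glue' x r => exact (α.map_push x r).trans (elim_glue T x r).symm
  | @hcomp' ρ φ hφ u u₀ h h₀ hn hs ih ih₀ =>
    obtain ⟨p, hp, hpu, hcomp_eq⟩ := exists_freeComp_eq c D φ hφ u u₀ h h₀ hn hs
    refine (congrArg (α.map.app ρ) hcomp_eq).symm.trans ?_
    refine (α.preserves φ p ⟨u₀, h₀⟩ hp).trans ?_
    have hp' : (p.map α.map).StartsAt (elim T u₀) := by
      rw [← ih₀]
      exact hp.map α.map
    refine (T.hcomp.comp_congr rfl ih₀ _ hp').trans ?_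
    refine (elim_hcomp T hφ u u₀ (p.map α.map) (fun f hf r => ?_) hp').symm
    exact (congrArg (α.map.app _) (hpu f hf r)).trans (ih f hf r)

variable (c D) in
/-- The algebra of coherent pre-terms is initial. -/
noncomputable def freeAlgebraIsInitial : Limits.IsInitial (freeAlgebra c D) :=
  Limits.IsInitial.ofUniqueHom freeDesc fun T α => by
    apply PushoutAlgebra.Hom.ext
    ext ρ t
    exact hom_app_eq_elim T α t.2

theorem freeComp_push {Δ : CSet.{w}} (σ : Δ ⟶ Γ) {e : Δ.Elements} (φ : face.obj e.1)
    (u : PartialPath (freeTy (c.precomp σ) D) e φ) (u₀ : (freeTy (c.precomp σ) D).obj e)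
    (h₀ : u.StartsAt u₀) :
    freeComp (c := c) (e := (CategoryOfElements.map σ).obj e) φ
      (PartialPath.push σ (A := freeTy c D) u) u₀ (PartialPath.StartsAt.push σ h₀) =
    freeComp φ u u₀ h₀ := by
  by_cases hφ : Holds φ
  · refine (freeComp_of_holds (c := c) (e := (CategoryOfElements.map σ).obj e) _ _ _ hφ).trans ?_
    rw [freeComp_of_holds u u₀ h₀ hφ]
    exact PartialPath.push_val σ (A := freeTy c D) u (𝟙 e) _ _
  · refine Subtype.ext ?_
    rw [freeComp_of_not_holds u u₀ h₀ hφ]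
    refine (freeComp_of_not_holds (c := c) (e := (CategoryOfElements.map σ).obj e)
      _ _ _ hφ).trans ?_
    have : pushTube (PartialPath.push σ (A := freeTy c D) u) = pushTube u := by
      refine TubeNatural.ext_of_code (c := c.precomp σ)
        (tubeNatural_pushTube (PartialPath.push σ (A := freeTy c D) u)) (tubeNatural_pushTube u) ?_
      intro e' f h r
      rw [pushTube_map u f h r]
      refine (pushTube_map (PartialPath.push σ (A := freeTy c D) u)
        ((CategoryOfElements.map σ).map f) h r).trans (congrArg Subtype.val ?_)
      exact PartialPath.push_val σ (A := freeTy c D) u f h r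
    rw [this]
    rfl

/-- The free algebra of a code is strictly stable under substitution: its fibre over `ρ` depends on
`c ρ` only. -/
theorem freeAlgebra_reindex {Δ : CSet.{w}} (σ : Δ ⟶ Γ) :
    (freeAlgebra c D).reindex σ = freeAlgebra (c.precomp σ) D := by
  have : ((freeAlgebra c D).reindex σ).hcomp = (freeAlgebra (c.precomp σ) D).hcomp :=
    HComp.ext (by
      funext e φ u u₀ h₀
      exact freeComp_push σ φ u u₀ h₀)
  exact congrArg (fun H => ({ freeAlgebra (c.precomp σ) D with hcomp := H } :
    PushoutAlgebra ((c.precomp σ).reindexSpan D))) this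

end Initiality

/-! ### The universe of spans -/

namespace Code

variable {Γ : CSet.{w}}

/-- The representable cubical set on `I`. -/
abbrev rep (I : Cubeᵒᵖ) : CSet.{0} := coyoneda.obj (op I)

/-- The map of representables induced by `f`. -/
def repMap {I J : Cubeᵒᵖ} (f : I ⟶ J) : Code (rep J) (rep I) where
  app g := f ≫ g
  natural g h := Category.assoc f h g

/-- The map from a representable that corresponds to `ρ` under the Yoneda lemma. -/
def point {I : Cubeᵒᵖ} (ρ : Γ.obj I) : Code (rep I) Γ where
  app f := Γ.map f ρ
  natural f g := (Functor.map_comp_apply Γ g f ρ).symm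

/-- Composition of codes. -/
def comp {Γ' : CSet.{v}} {U : CSet.{u}} (c : Code Γ Γ') (d : Code Γ' U) : Code Γ U where
  app ρ := d.app (c.app ρ)
  natural f ρ := by rw [d.natural, c.natural]

/-- The identity code. -/
def refl (Γ : CSet.{w}) : Code Γ Γ where
  app ρ := ρ
  natural _ _ := rfl

theorem repMap_id (I : Cubeᵒᵖ) : repMap (𝟙 I) = refl (rep I) := by
  ext J f
  exact Category.id_comp f

theorem repMap_comp {I J K : Cubeᵒᵖ} (f : I ⟶ J) (g : J ⟶ K) :
    repMap (f ≫ g) = (repMap g).comp (repMap f) := by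
  ext L h
  exact Category.assoc f g h

theorem repMap_comp_point {I J : Cubeᵒᵖ} (f : I ⟶ J) (ρ : Γ.obj I) :
    (repMap f).comp (point ρ) = point (Γ.map f ρ) := by
  ext K g
  exact Functor.map_comp_apply Γ f g ρ

theorem point_precomp {Δ : CSet.{w}} (σ : Δ ⟶ Γ) {I : Cubeᵒᵖ} (ρ : Δ.obj I) :
    (point ρ).comp ((refl Γ).precomp σ) = point (σ.app I ρ) := by
  ext K g
  exact NatTrans.naturality_apply σ g ρ

end Code

section SpanUniverse

open Code

/-- The Hofmann–Streicher universe of spans: its elements at `I` are the spans of types over the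
representable on `I`. -/
def spanUniverse : CSet.{v + 1} where
  obj I := TySpan.{0, v} (rep I)
  map f := ↾(repMap f).reindexSpan
  map_id I := by
    ext D
    exact congrArg (fun c : Code _ _ => c.reindexSpan D) (repMap_id I)
  map_comp f g := by
    ext D
    exact congrArg (fun c : Code _ _ => c.reindexSpan D) (repMap_comp f g)

/-- The restriction map of the generic span: restriction of `A` along `f` from the generic element
of the representable, followed by the transport along `h`. -/
def evalMap {I J : Cubeᵒᵖ} (f : I ⟶ J) {A : Ty.{0, v} (rep I)} {A' : Ty.{0, v} (rep J)}
    (h : (repMap f).reindexTy A = A') : A.obj ⟨I, 𝟙 I⟩ ⟶ A'.obj ⟨J, 𝟙 J⟩ :=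
  A.map (Y := ⟨J, f ≫ 𝟙 J⟩) ⟨f, (Category.id_comp f).trans (Category.comp_id f).symm⟩ ≫
    (eqToHom h).app ⟨J, 𝟙 J⟩

/-- If `A` and `A'` are substitutions of a type `X`, then the transport in `evalMap` is the
identity of a value of `X`. -/
theorem evalMap_reindexTy {Γ : CSet.{w}} (X : Ty.{w, v} Γ) {I J : Cubeᵒᵖ} (f : I ⟶ J)
    {c : Code (rep I) Γ} {c' : Code (rep J) Γ} (hc : (repMap f).comp c = c')
    (h : (repMap f).reindexTy (c.reindexTy X) = c'.reindexTy X)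
    (k : c.elements.obj ⟨I, 𝟙 I⟩ ⟶ c'.elements.obj ⟨J, 𝟙 J⟩) (hk : k.val = f) :
    evalMap f h = X.map k := by
  subst hc
  refine (Category.comp_id (X.map _)).trans ?_
  exact congrArg X.map (CategoryOfElements.ext _ _ _ hk.symm)

theorem evalMap_id {I : Cubeᵒᵖ} {A : Ty.{0, v} (rep I)} (h : (repMap (𝟙 I)).reindexTy A = A) :
    evalMap (𝟙 I) h = 𝟙 _ :=
  (evalMap_reindexTy A (𝟙 I) (c := refl (rep I)) (c' := refl (rep I)) (repMap_id I) h (𝟙 _) rfl).trans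
    (A.map_id _)

theorem evalMap_comp {I J K : Cubeᵒᵖ} (f : I ⟶ J) (g : J ⟶ K) {A : Ty.{0, v} (rep I)}
    {A' : Ty.{0, v} (rep J)} {A'' : Ty.{0, v} (rep K)} (h : (repMap f).reindexTy A = A')
    (h' : (repMap g).reindexTy A' = A'') (h'' : (repMap (f ≫ g)).reindexTy A = A'') :
    evalMap (f ≫ g) h'' = evalMap f h ≫ evalMap g h' := by
  subst h h'
  let kf : (refl (rep I)).elements.obj ⟨I, 𝟙 I⟩ ⟶ (repMap f).elements.obj ⟨J, 𝟙 J⟩ :=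
    ⟨f, (Category.id_comp f).trans (Category.comp_id f).symm⟩
  let kg : (repMap f).elements.obj ⟨J, 𝟙 J⟩ ⟶ ((repMap g).comp (repMap f)).elements.obj ⟨K, 𝟙 K⟩ :=
    (repMap f).elements.map (X := ⟨J, 𝟙 J⟩) (Y := ⟨K, g ≫ 𝟙 K⟩)
      ⟨g, (Category.id_comp g).trans (Category.comp_id g).symm⟩
  refine (evalMap_reindexTy A (f ≫ g) (c := refl (rep I)) (c' := (repMap g).comp (repMap f))
    (repMap_comp f g) h'' (kf ≫ kg) rfl).trans ?_
  refine (A.map_comp kf kg).trans (congrArg₂ (· ≫ ·) ?_ ?_)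
  · exact (evalMap_reindexTy A f (c := refl (rep I)) (c' := repMap f) rfl rfl kf rfl).symm
  · exact (evalMap_reindexTy A g (c := repMap f) (c' := (repMap g).comp (repMap f))
      rfl rfl kg rfl).symm

theorem evalMap_naturality {I J : Cubeᵒᵖ} (f : I ⟶ J) {A B : Ty.{0, v} (rep I)}
    (α : A ⟶ B) : evalMap f rfl ≫ (Functor.whiskerLeft (repMap f).elements α).app ⟨J, 𝟙 J⟩ =
      α.app ⟨I, 𝟙 I⟩ ≫ evalMap f (A := B) rfl := by
  refine (congrArg (· ≫ _) (Category.comp_id _)).trans ?_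
  refine Eq.trans ?_ (congrArg (α.app ⟨I, 𝟙 I⟩ ≫ ·) (Category.comp_id _).symm)
  exact α.naturality _

/-- The generic span over the universe of spans: its value at a span `D` over the representable on
`I` is the value of `D` at the generic element `𝟙 I`. -/
def genericSpan : TySpan.{v + 1, v} spanUniverse.{v} where
  C :=
    { obj := fun e => e.2.C.obj ⟨e.1, 𝟙 e.1⟩
      map := fun f => evalMap f.val (congrArg TySpan.C f.property)
      map_id := fun _ => evalMap_id _
      map_comp := fun f g => evalMap_comp f.val g.val _ _ _ }
  A :=
    { obj := fun e => e.2.A.obj ⟨e.1, 𝟙 e.1⟩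
      map := fun f => evalMap f.val (congrArg TySpan.A f.property)
      map_id := fun _ => evalMap_id _
      map_comp := fun f g => evalMap_comp f.val g.val _ _ _ }
  B :=
    { obj := fun e => e.2.B.obj ⟨e.1, 𝟙 e.1⟩
      map := fun f => evalMap f.val (congrArg TySpan.B f.property)
      map_id := fun _ => evalMap_id _
      map_comp := fun f g => evalMap_comp f.val g.val _ _ _ }
  u :=
    { app := fun e => e.2.u.app ⟨e.1, 𝟙 e.1⟩
      naturality := fun e _ f => homCases (fun _ f => evalMap_naturality f e.2.u) f }
  v :=
    { app := fun e => e.2.v.app ⟨e.1, 𝟙 e.1⟩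
      naturality := fun e _ f => homCases (fun _ f => evalMap_naturality f e.2.v) f }

variable {Γ : CSet.{w}}

/-- The map into the universe that classifies a span. -/
def nameSpan (D : TySpan.{w, v} Γ) : Code Γ spanUniverse.{v} where
  app ρ := (point ρ).reindexSpan D
  natural f ρ := congrArg (fun c : Code _ _ => c.reindexSpan D) (repMap_comp_point f ρ)

theorem nameSpan_reindex {Δ : CSet.{w}} (σ : Δ ⟶ Γ) (D : TySpan.{w, v} Γ) :
    nameSpan (D.reindex σ) = (nameSpan D).precomp σ := by
  ext I ρ
  exact congrArg (fun c : Code _ _ => c.reindexSpan D) (point_precomp σ ρ)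

/-- A map of types whose components are identities up to equality of sets is itself such an
identity. -/
theorem Ty.eq_of_app_eq_eqToHom {A B : Ty.{w, v} Γ} (α : A ⟶ B)
    (h : ∀ e, ∃ h : A.obj e = B.obj e, α.app e = eqToHom h) : ∃ h : A = B, α = eqToHom h := by
  have hAB : A = B := CategoryTheory.Functor.ext (fun e => (h e).1) fun e e' f => by
    rw [← (h e).2, ← Category.assoc, ← α.naturality, (h e').2]
    simp
  refine ⟨hAB, ?_⟩
  subst hAB
  exact NatTrans.ext (funext fun e => (h e).2)

theorem TySpan.eq_of_maps {D D' : TySpan.{w, v} Γ} (γ : D.C ⟶ D'.C) (α : D.A ⟶ D'.A)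
    (β : D.B ⟶ D'.B) (hγ : ∀ e, ∃ h : D.C.obj e = D'.C.obj e, γ.app e = eqToHom h)
    (hα : ∀ e, ∃ h : D.A.obj e = D'.A.obj e, α.app e = eqToHom h)
    (hβ : ∀ e, ∃ h : D.B.obj e = D'.B.obj e, β.app e = eqToHom h)
    (hu : D.u ≫ α = γ ≫ D'.u) (hv : D.v ≫ β = γ ≫ D'.v) : D = D' := by
  obtain ⟨C, A, B, u, v⟩ := D
  obtain ⟨C', A', B', u', v'⟩ := D'
  dsimp only at γ α β hγ hα hβ hu hv
  obtain ⟨rfl, rfl⟩ := Ty.eq_of_app_eq_eqToHom γ hγ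
  obtain ⟨rfl, rfl⟩ := Ty.eq_of_app_eq_eqToHom α hα
  obtain ⟨rfl, rfl⟩ := Ty.eq_of_app_eq_eqToHom β hβ
  obtain rfl : u = u' := by simpa using hu
  obtain rfl : v = v' := by simpa using hv
  rfl

theorem res_id (e : Γ.Elements) : res e (𝟙 e.1) = e :=
  Sigma.ext rfl (heq_of_eq (Functor.map_id_apply Γ _ _))

theorem eqToHom_res_id_val (e : Γ.Elements) : (eqToHom (res_id e)).val = 𝟙 e.1 := by
  have : ∀ {e' : Γ.Elements} (h : e' = e) (k : e' ⟶ e) (h₁ : e'.1 = e.1),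
      k = eqToHom h → k.val = eqToHom h₁ := by
    rintro _ rfl _ _ rfl
    rfl
  exact this (res_id e) _ rfl rfl

/-- Every span is the substitution of the generic span along the map that classifies it. -/
theorem nameSpan_reindexSpan (D : TySpan.{w, v} Γ) :
    (nameSpan D).reindexSpan genericSpan = D := by
  have key : ∀ (X : Ty.{w, v} Γ) {e e' : Γ.Elements} (f : e ⟶ e')
      (h : (repMap f.val).reindexTy ((point e.2).reindexTy X) = (point e'.2).reindexTy X),
      evalMap f.val h ≫ X.map (eqToHom (res_id e')) = X.map (eqToHom (res_id e)) ≫ X.map f := by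
    intro X e e' f h
    have hk : Γ.map f.val (Γ.map (𝟙 e.1) e.2) = Γ.map (𝟙 e'.1) e'.2 := by
      rw [Functor.map_id_apply, Functor.map_id_apply]
      exact f.property
    rw [evalMap_reindexTy X f.val (c := point e.2) (c' := point e'.2)
      ((repMap_comp_point f.val e.2).trans (congrArg point f.property)) h ⟨f.val, hk⟩ rfl]
    refine (X.map_comp _ _).symm.trans (Eq.trans (congrArg X.map ?_) (X.map_comp _ _))
    refine CategoryOfElements.ext _ _ _ ?_
    change f.val ≫ (eqToHom (res_id e')).val = (eqToHom (res_id e)).val ≫ f.val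
    rw [eqToHom_res_id_val, eqToHom_res_id_val, Category.comp_id, Category.id_comp]
  refine TySpan.eq_of_maps
    { app := fun e => D.C.map (eqToHom (res_id e)), naturality := fun _ _ f => key D.C f _ }
    { app := fun e => D.A.map (eqToHom (res_id e)), naturality := fun _ _ f => key D.A f _ }
    { app := fun e => D.B.map (eqToHom (res_id e)), naturality := fun _ _ f => key D.B f _ }
    (fun e => ⟨congrArg D.C.obj (res_id e), eqToHom_map _ _⟩)
    (fun e => ⟨congrArg D.A.obj (res_id e), eqToHom_map _ _⟩)
    (fun e => ⟨congrArg D.B.obj (res_id e), eqToHom_map _ _⟩) ?_ ?_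
  · ext e : 2
    exact (D.u.naturality (eqToHom (res_id e))).symm
  · ext e : 2
    exact (D.v.naturality (eqToHom (res_id e))).symm

end SpanUniverse

/-! ### Pushouts -/

/-- The pushout: the free algebra of the map classifying `D`, transported along the equality of `D`
with the span that it classifies. -/
noncomputable def pushout {Γ : CSet.{w}} (D : TySpan.{w, v} Γ) : PushoutAlgebra D :=
  nameSpan_reindexSpan D ▸ freeAlgebra (nameSpan D) genericSpan

theorem pushout_isInitial {Γ : CSet.{w}} (D : TySpan.{w, v} Γ) :
    Nonempty (Limits.IsInitial (pushout D)) := by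
  have key : ∀ {D' : TySpan.{w, v} Γ} (h : (nameSpan D).reindexSpan genericSpan = D'),
      Nonempty (Limits.IsInitial (h ▸ freeAlgebra (nameSpan D) genericSpan : PushoutAlgebra D')) := by
    rintro _ rfl
    exact ⟨freeAlgebraIsInitial _ _⟩
  exact key _

/-- Stability of the free algebra, transported along the classification of the span. -/
theorem freeAlgebra_transport_reindex {Δ Γ : CSet.{w}} (σ : Δ ⟶ Γ) {U : CSet.{u}}
    {E : TySpan.{u, v} U} {c : Code Γ U} {c' : Code Δ U} {D : TySpan.{w, v} Γ}
    (h : c.reindexSpan E = D) (h' : c'.reindexSpan E = D.reindex σ) (hc : c' = c.precomp σ) :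
    (h ▸ freeAlgebra c E : PushoutAlgebra D).reindex σ =
      (h' ▸ freeAlgebra c' E : PushoutAlgebra (D.reindex σ)) := by
  subst h hc
  exact freeAlgebra_reindex σ

theorem pushout_reindex {Δ Γ : CSet.{w}} (σ : Δ ⟶ Γ) (D : TySpan.{w, v} Γ) :
    (pushout D).reindex σ = pushout (D.reindex σ) :=
  freeAlgebra_transport_reindex σ _ _ (nameSpan_reindex σ D)

/-! ### Suspensions -/

/-- The span `1 ← X → 1`. -/
def suspSpan {Γ : CSet.{w}} (X : Ty.{w, v} Γ) : TySpan.{w, v} Γ where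
  C := X
  A := (Functor.const _).obj PUnit
  B := (Functor.const _).obj PUnit
  u := { app := fun _ => ↾fun _ => PUnit.unit }
  v := { app := fun _ => ↾fun _ => PUnit.unit }

namespace PushoutAlgebra

variable {Γ : CSet.{w}} {X : Ty.{w, v} Γ}

/-- An algebra for `1 ← X → 1` as a `ΣX`-algebra. -/
def toSusp (S : PushoutAlgebra (suspSpan X)) : SuspAlgebra X where
  carrier := S.carrier
  hcomp := S.hcomp
  north :=
    { val := fun e => S.inl.app e PUnit.unit
      natural := fun f => (NatTrans.naturality_apply S.inl f PUnit.unit).symm }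
  south :=
    { val := fun e => S.inr.app e PUnit.unit
      natural := fun f => (NatTrans.naturality_apply S.inr f PUnit.unit).symm }
  merid := S.push
  merid_zero x := S.push_zero x
  merid_one x := S.push_one x

end PushoutAlgebra

namespace SuspAlgebra

variable {Γ : CSet.{w}} {X : Ty.{w, v} Γ}

/-- A `ΣX`-algebra as an algebra for `1 ← X → 1`. -/
def toPushout (S : SuspAlgebra X) : PushoutAlgebra (suspSpan X) where
  carrier := S.carrier
  hcomp := S.hcomp
  inl :=
    { app := fun e => ↾fun _ => S.north.val e
      naturality := fun e e' f => by
        ext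
        exact (S.north.natural f).symm }
  inr :=
    { app := fun e => ↾fun _ => S.south.val e
      naturality := fun e e' f => by
        ext
        exact (S.south.natural f).symm }
  push := S.merid
  push_zero x := S.merid_zero x
  push_one x := S.merid_one x

/-- Maps of algebras are the same in both readings. -/
def homEquiv (S : PushoutAlgebra (suspSpan X)) (T : SuspAlgebra X) :
    (S ⟶ T.toPushout) ≃ (S.toSusp ⟶ T) where
  toFun α :=
    { map := α.map
      preserves := α.preserves
      map_north := fun _ => α.map_inl PUnit.unit
      map_south := fun _ => α.map_inr PUnit.unit
      map_merid := α.map_push }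
  invFun α :=
    { map := α.map
      preserves := α.preserves
      map_inl := fun {e} _ => α.map_north e
      map_inr := fun {e} _ => α.map_south e
      map_push := α.map_merid }
  left_inv _ := rfl
  right_inv _ := rfl

/-- Suspensions are pushouts of `1 ← X → 1`. -/
def isInitialToSusp {S : PushoutAlgebra (suspSpan X)} (hS : Limits.IsInitial S) :
    Limits.IsInitial S.toSusp :=
  Limits.IsInitial.ofUniqueHom (fun T => homEquiv S T (hS.to _)) fun T _ =>
    ((homEquiv S T).eq_symm_apply.1 (hS.hom_ext _ _)).symm

end SuspAlgebra

end CubicalSets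

theorem mainTheorem2 :
    (∃ susp : ∀ (Γ : CubicalSets.CSet.{w}) (X : CubicalSets.Ty.{w, v} Γ),
        CubicalSets.SuspAlgebra X,
      (∀ (Γ : CubicalSets.CSet.{w}) (X : CubicalSets.Ty.{w, v} Γ),
        Nonempty (Limits.IsInitial (susp Γ X))) ∧
      (∀ (Δ Γ : CubicalSets.CSet.{w}) (σ : Δ ⟶ Γ) (X : CubicalSets.Ty.{w, v} Γ),
        (susp Γ X).reindex σ = susp Δ (X.reindex σ))) ∧
    (∃ po : ∀ (Γ : CubicalSets.CSet.{w}) (D : CubicalSets.TySpan.{w, v} Γ),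
        CubicalSets.PushoutAlgebra D,
      (∀ (Γ : CubicalSets.CSet.{w}) (D : CubicalSets.TySpan.{w, v} Γ),
        Nonempty (Limits.IsInitial (po Γ D))) ∧
      (∀ (Δ Γ : CubicalSets.CSet.{w}) (σ : Δ ⟶ Γ) (D : CubicalSets.TySpan.{w, v} Γ),
        (po Γ D).reindex σ = po Δ (D.reindex σ))) := by
  refine ⟨⟨fun Γ X => (CubicalSets.pushout (CubicalSets.suspSpan X)).toSusp,
      fun Γ X => ?_, fun Δ Γ σ X => ?_⟩,
    fun Γ D => CubicalSets.pushout D, fun Γ D => CubicalSets.pushout_isInitial D,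
    fun Δ Γ σ D => CubicalSets.pushout_reindex σ D⟩
  · obtain ⟨h⟩ := CubicalSets.pushout_isInitial (CubicalSets.suspSpan X)
    exact ⟨CubicalSets.SuspAlgebra.isInitialToSusp h⟩
  · exact congrArg (CubicalSets.PushoutAlgebra.toSusp (X := X.reindex σ))
      (CubicalSets.pushout_reindex σ (CubicalSets.suspSpan X))
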